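/- Let $G$ be a simplicial group with face maps $d_i$ and degeneracies $s_i$. Let $(NG,\partial)$ be its Moore complex, $NG_n=\bigcap_{i=0}^{n-1}\operatorname{Ker}(d_i\colon G_n\to G_{n-1})$ with $\partial_n$ the restriction of $d_n$, and let $\pi_n(G)=H_n(NG,\partial)$. Let $\mathfrak M(G,2)$ be the crossed square $$\begin{array}{ccc} NG_2/\partial_3NG_3 & \xrightarrow{\ \mu_2\ } & \operatorname{Ker}(d_0\colon G_1\to G_0)\\ {\scriptstyle\mu_1}\downarrow & & \downarrow{\scriptstyle\mu_1}\\ \operatorname{Ker}(d_1\colon G_1\to G_0) & \xrightarrow{\ \mu_2\ } & G_1\end{array}$$ in which the maps out of the top left corner are induced by $d_2$, the other two maps are inclusions, $G_1$ acts by conjugation (via $s_1$ on the top left corner), and the $h$-map is $h(x,y)=[s_1x,\;s_1y\,s_0y^{-1}]\,\partial_3NG_3$ for $x\in\operatorname{Ker}d_0$, $y\in\operatorname{Ker}d_1$. Let $X$ be its bisimplicial nerve, i.e. the nerve, taken in both directions, of the associated cat$^2$-group regarded as a double groupoid internal to groups, and let $\nabla X$ be the Artin–Mazur codiagonal of $X$: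 the simplicial group with $$(\nabla X)_n=\Big\{(x_0,\dots,x_n)\in\prod_{p=0}^{n}X_{p,n-p}\ :\ d_0^vx_p=d_{p+1}^hx_{p+1}\ \text{ for } 0\le p<n\Big\},$$ with $d_j(x_0,\dots,x_n)=(d_j^vx_0,\dots,d_1^vx_{j-1},d_j^hx_{j+1},\dots,d_j^hx_n)$ and $s_i(x_0,\dots,x_n)=(s_i^vx_0,\dots,s_0^vx_i,s_i^hx_i,\dots,s_i^hx_n)$. Then the Moore complex of $\nabla X$ is isomorphic, as a complex of groups, to $$\cdots\to 1\to NG_2/\partial_3NG_3\ \xrightarrow{\ (\mu_2^{-1},\,\mu_1)\ }\ \operatorname{Ker}d_0\rtimes\operatorname{Ker}d_1\ \xrightarrow{\ \mu_1\mu_2\ }\ G_1,$$ concentrated in degrees $0,1,2$, where $\operatorname{Ker}d_1$ acts on $\operatorname{Ker}d_0$ by conjugation in $G_1$ and the maps are $l\mapsto(\mu_2(l)^{-1},\mu_1(l))$ and $(m,n)\mapsto mn$. For $n=0,1,2$ the $n$-th homology group of this complex, and hence $\pi_n(\nabla X)$, is isomorphic to $\pi_n(G)$. -/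

import Mathlib

universe u

namespace CrossedSquares

open CategoryTheory Opposite

/-! ### Normal chain complexes of groups -/

/-- A chain complex of (not necessarily abelian) groups, indexed by `ℕ`, such that the image of
each differential is a normal subgroup. -/
structure NormalComplex where
  X : ℕ → Type u
  [group : ∀ n, Group (X n)]
  d : ∀ n, X (n + 1) →* X n
  d_comp_d : ∀ n x, d n (d (n + 1) x) = 1
  normal_range : ∀ n, (d n).range.Normal

attribute [instance] NormalComplex.group NormalComplex.normal_range

namespace NormalComplex

/-- The cycles: everything in degree `0`, the kernel of the differential in positive degrees. -/
def cycles (C : NormalComplex.{u}) : (n : ℕ) → Subgroup (C.X n)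
  | 0 => ⊤
  | n + 1 => (C.d n).ker

/-- The `n`-th homology group: cycles modulo boundaries. -/
abbrev homology (C : NormalComplex.{u}) (n : ℕ) : Type u :=
  C.cycles n ⧸ (C.d n).range.subgroupOf (C.cycles n)

/-- An isomorphism of complexes: isomorphisms in all degrees, commuting with the differentials. -/
structure Iso (C D : NormalComplex.{u}) where
  equiv : ∀ n, C.X n ≃* D.X n
  comm : ∀ n x, equiv n (C.d n x) = D.d n (equiv (n + 1) x)

end NormalComplex

/-! ### Simplicial groups: Moore complex and homotopy groups -/

/-- Simplicial groups. -/
abbrev SimplicialGroup := SimplicialObject GrpCat.{u}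

section Moore

variable (G : SimplicialGroup.{u})

/-- The face `d_i : G_{n+1} → G_n`. -/
abbrev face (n : ℕ) (i : Fin (n + 2)) :
    G.obj (op (SimplexCategory.mk (n + 1))) →* G.obj (op (SimplexCategory.mk n)) := (G.δ i).hom

/-- The degeneracy `s_i : G_n → G_{n+1}`. -/
abbrev degen (n : ℕ) (i : Fin (n + 1)) :
    G.obj (op (SimplexCategory.mk n)) →* G.obj (op (SimplexCategory.mk (n + 1))) := (G.σ i).hom

/-- `NG_n`, the intersection of the kernels of `d_0, …, d_{n-1}` in `G_n`. -/
def moore : (n : ℕ) → Subgroup (G.obj (op (SimplexCategory.mk n)))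
  | 0 => ⊤
  | n + 1 => ⨅ i : Fin (n + 1), (face G n i.castSucc).ker

open scoped Simplicial

theorem face_face (n : ℕ) (i j : Fin (n + 2)) (h : i ≤ j) (x : G _⦋n + 2⦌) :
    face G n i (face G (n + 1) j.succ x) = face G n j (face G (n + 1) i.castSucc x) :=
  ConcreteCategory.congr_hom (G.δ_comp_δ h) x

theorem face_degen_self (n : ℕ) (i : Fin (n + 1)) (x : G _⦋n⦌) :
    face G n i.castSucc (degen G n i x) = x :=
  ConcreteCategory.congr_hom (G.δ_comp_σ_self (i := i)) x

theorem face_degen_succ (n : ℕ) (i : Fin (n + 1)) (x : G _⦋n⦌) :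
    face G n i.succ (degen G n i x) = x :=
  ConcreteCategory.congr_hom (G.δ_comp_σ_succ (i := i)) x

theorem face_degen_le (n : ℕ) (i : Fin (n + 2)) (j : Fin (n + 1)) (h : i ≤ j.castSucc)
    (x : G _⦋n + 1⦌) :
    face G (n + 1) i.castSucc (degen G (n + 1) j.succ x) = degen G n j (face G n i x) :=
  ConcreteCategory.congr_hom (G.δ_comp_σ_of_le h) x

theorem face_degen_gt (n : ℕ) (i : Fin (n + 2)) (j : Fin (n + 1)) (h : j.castSucc < i)
    (x : G _⦋n + 1⦌) :
    face G (n + 1) i.succ (degen G (n + 1) j.castSucc x) = degen G n j (face G n i x) :=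
  ConcreteCategory.congr_hom (G.δ_comp_σ_of_gt h) x

theorem mem_moore_succ (n : ℕ) (x : G _⦋n + 1⦌) :
    x ∈ moore G (n + 1) ↔ ∀ i : Fin (n + 1), face G n i.castSucc x = 1 := by
  simp only [moore, Subgroup.mem_iInf, MonoidHom.mem_ker]

instance moore_normal (n : ℕ) : (moore G n).Normal := by
  cases n with
  | zero => unfold moore; infer_instance
  | succ n =>
    refine ⟨fun x hx g => ?_⟩
    rw [mem_moore_succ] at hx ⊢
    intro i
    rw [map_mul, map_mul, hx i, map_inv, mul_one, mul_inv_cancel]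

theorem face_last_mem (n : ℕ) (x : G _⦋n + 1⦌) (hx : x ∈ moore G (n + 1)) :
    face G n (Fin.last (n + 1)) x ∈ moore G n := by
  cases n with
  | zero => exact Subgroup.mem_top _
  | succ n =>
    rw [mem_moore_succ] at hx ⊢
    intro i
    have h := face_face G n i.castSucc (Fin.last (n + 1)) (Fin.le_last _) x
    rw [Fin.succ_last] at h
    rw [h, hx i.castSucc, map_one]

/-- The differential of the Moore complex, the restriction of the last face. -/
def mooreD (n : ℕ) : moore G (n + 1) →* moore G n :=
  ((face G n (Fin.last (n + 1))).comp (moore G (n + 1)).subtype).codRestrict (moore G n)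
    fun x => face_last_mem G n x x.2

theorem coe_mooreD (n : ℕ) (x : moore G (n + 1)) :
    (mooreD G n x : G _⦋n⦌) = face G n (Fin.last (n + 1)) x := rfl

theorem conj_face_last (n : ℕ) (g : G _⦋n⦌) (z : moore G (n + 1)) :
    ∃ w : moore G (n + 1), face G n (Fin.last (n + 1)) w =
      g * face G n (Fin.last (n + 1)) z * g⁻¹ := by
  have hs := face_degen_succ G n (Fin.last n) g
  rw [Fin.succ_last] at hs
  exact ⟨⟨degen G n (Fin.last n) g * z * (degen G n (Fin.last n) g)⁻¹,
    (moore_normal G (n + 1)).conj_mem z z.2 _⟩, by simp only [map_mul, map_inv, hs]⟩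

/-- The Moore complex of a simplicial group. -/
def mooreComplex : NormalComplex.{u} where
  X n := moore G n
  d := mooreD G
  d_comp_d n x := by
    apply Subtype.ext
    have hx := (mem_moore_succ G (n + 1) x).1 x.2 (Fin.last (n + 1))
    have h := face_face G n (Fin.last (n + 1)) (Fin.last (n + 1)) le_rfl x
    rw [Fin.succ_last] at h
    rw [coe_mooreD, coe_mooreD, h, hx, map_one]
    rfl
  normal_range n := by
    refine ⟨?_⟩
    rintro _ ⟨z, rfl⟩ g
    obtain ⟨w, hw⟩ := conj_face_last G n g z
    exact ⟨w, Subtype.ext hw⟩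

/-- The homotopy groups of a simplicial group: the homology of its Moore complex. -/
abbrev homotopyGroup (n : ℕ) : Type u := (mooreComplex G).homology n

end Moore

/-! ### Bisimplicial groups and the Artin–Mazur codiagonal -/

/-- Bisimplicial groups; the first index is the horizontal one, the second the vertical one. -/
abbrev BisimplicialGroup := (SimplexCategory × SimplexCategory)ᵒᵖ ⥤ GrpCat.{u}

section Codiagonal

open scoped Simplicial

/-- The inclusion `[p] → [q]` of an initial segment. -/
def initialIncl (p q : ℕ) (h : p ≤ q) : ⦋p⦌ ⟶ ⦋q⦌ :=
  SimplexCategory.Hom.mk ⟨fun i => ⟨i.1, by have := i.2; simp at this ⊢; omega⟩, fun _ _ h => h⟩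

/-- The inclusion `[n - q] → [n - p]`, `i ↦ i + (q - p)`, of a final segment. -/
def finalIncl (n p q : ℕ) (h : p ≤ q) (hq : q ≤ n) : ⦋n - q⦌ ⟶ ⦋n - p⦌ :=
  SimplexCategory.Hom.mk ⟨fun i => ⟨i.1 + (q - p), by have := i.2; simp at this ⊢; omega⟩,
    fun _ _ h => Nat.add_le_add_right h _⟩

/-- The restriction `{0, …, p} → {0, …, θ p}` of a monotone map `θ`. -/
def lowerPart {m n : SimplexCategory} (θ : m ⟶ n) (p : Fin (m.len + 1)) :
    ⦋p.1⦌ ⟶ ⦋(θ.toOrderHom p).1⦌ :=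
  SimplexCategory.Hom.mk ⟨fun i => ⟨(θ.toOrderHom ⟨i.1, by
      have := i.2; have := p.2; simp only [SimplexCategory.len_mk] at *; omega⟩).1, by
      refine Nat.lt_succ_of_le (θ.toOrderHom.monotone ?_)
      exact Nat.le_of_lt_succ i.2⟩,
    fun _ _ h => θ.toOrderHom.monotone h⟩

/-- The restriction `{p, …, m} → {θ p, …, n}` of a monotone map `θ : [m] → [n]`, both segments
being renumbered from `0`. -/
def upperPart {m n : SimplexCategory} (θ : m ⟶ n) (p : Fin (m.len + 1)) :
    ⦋m.len - p.1⦌ ⟶ ⦋n.len - (θ.toOrderHom p).1⦌ :=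
  SimplexCategory.Hom.mk ⟨fun i => ⟨(θ.toOrderHom ⟨p.1 + i.1, by
      have := i.2; have := p.2; simp only [SimplexCategory.len_mk] at *; omega⟩).1 -
        (θ.toOrderHom p).1, by
      have := (θ.toOrderHom ⟨p.1 + i.1, by
        have := i.2; have := p.2; simp only [SimplexCategory.len_mk] at *; omega⟩).2
      simp only [SimplexCategory.len_mk]; omega⟩,
    fun i j h => Nat.sub_le_sub_right (θ.toOrderHom.monotone
      (show p.1 + i.1 ≤ p.1 + j.1 from Nat.add_le_add_left h _)) _⟩

variable (X : BisimplicialGroup.{u})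

/-- The action of a pair of monotone maps on a bisimplicial group. -/
abbrev biMap {a b c d : SimplexCategory} (f : a ⟶ c) (g : b ⟶ d) :
    X.obj (op (c, d)) →* X.obj (op (a, b)) :=
  (X.map (Prod.mkHom f g).op).hom

theorem biMap_biMap {a b c d e k : SimplexCategory} (f : a ⟶ c) (g : b ⟶ d) (f' : c ⟶ e)
    (g' : d ⟶ k) (x : X.obj (op (e, k))) :
    biMap X f g (biMap X f' g' x) = biMap X (f ≫ f') (g ≫ g') x :=
  (ConcreteCategory.congr_hom (X.map_comp (Prod.mkHom f' g').op (Prod.mkHom f g).op) x).symm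

/-- The group `(∇X)_n`: the tuples `(x_0, …, x_n)` with `x_p ∈ X_{p, n-p}` and
`d_0^v x_p = d_{p+1}^h x_{p+1}` for `0 ≤ p < n`. -/
def codiagSubgroup (n : ℕ) : Subgroup (∀ p : Fin (n + 1), X.obj (op (⦋p.1⦌, ⦋n - p.1⦌))) where
  carrier := {x | ∀ (p : ℕ) (hp : p < n),
    biMap X (𝟙 ⦋p⦌) (finalIncl n p (p + 1) p.le_succ hp) (x ⟨p, by omega⟩) =
      biMap X (initialIncl p (p + 1) p.le_succ) (𝟙 ⦋n - (p + 1)⦌) (x ⟨p + 1, by omega⟩)}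
  one_mem' p hp := by simp only [Pi.one_apply, map_one]
  mul_mem' hx hy p hp := by simp only [Pi.mul_apply, map_mul, hx p hp, hy p hp]
  inv_mem' hx p hp := by simp only [Pi.inv_apply, map_inv, hx p hp]

theorem codiag_compat (n : ℕ) (x : codiagSubgroup X n) (p q : ℕ) (h : p ≤ q) (hq : q ≤ n) :
    biMap X (𝟙 ⦋p⦌) (finalIncl n p q h hq) (x.1 ⟨p, by omega⟩) =
      biMap X (initialIncl p q h) (𝟙 ⦋n - q⦌) (x.1 ⟨q, by omega⟩) := by
  induction q, h using Nat.le_induction with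
  | base =>
    have e1 : finalIncl n p p le_rfl hq = 𝟙 _ := by
      ext i : 3
      apply Fin.ext
      change i.1 + (p - p) = i.1
      omega
    rw [e1]
    rfl
  | succ q h ih =>
    have h1 := ih (by omega)
    have h2 := x.2 q (by omega)
    have e1 : finalIncl n p (q + 1) (by omega) hq =
        finalIncl n q (q + 1) (by omega) hq ≫ finalIncl n p q h (by omega) := by
      ext i : 3
      apply Fin.ext
      change i.1 + (q + 1 - p) = i.1 + (q + 1 - q) + (q - p)
      omega
    have e2 : initialIncl p (q + 1) (by omega) =
        initialIncl p q h ≫ initialIncl q (q + 1) (by omega) := rfl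
    calc _ = biMap X (𝟙 ⦋p⦌) (finalIncl n q (q + 1) (by omega) hq)
          (biMap X (𝟙 ⦋p⦌) (finalIncl n p q h (by omega)) (x.1 ⟨p, by omega⟩)) := by
            rw [biMap_biMap, e1, Category.comp_id]
      _ = biMap X (initialIncl p q h) (𝟙 _)
          (biMap X (𝟙 _) (finalIncl n q (q + 1) (by omega) hq) (x.1 ⟨q, by omega⟩)) := by
            rw [h1, biMap_biMap, biMap_biMap]
            simp only [Category.id_comp, Category.comp_id]
      _ = _ := by
            rw [h2, biMap_biMap, e2, Category.comp_id]

/-- The map `θ^* : (∇X)_n → (∇X)_m` induced by `θ : [m] → [n]`; its `p`-th component is the image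
of `x_{θ p}` under the restrictions of `θ` to `{0, …, p}` and to `{p, …, m}`. For a coface or a
codegeneracy `θ` this gives
`d_j x = (d_j^v x_0, d_{j-1}^v x_1, …, d_1^v x_{j-1}, d_j^h x_{j+1}, …, d_j^h x_n)` and
`s_i x = (s_i^v x_0, s_{i-1}^v x_1, …, s_0^v x_i, s_i^h x_i, …, s_i^h x_n)`. -/
def codiagMap {m n : SimplexCategory} (θ : m ⟶ n) :
    codiagSubgroup X n.len →* codiagSubgroup X m.len where
  toFun x := ⟨fun p => biMap X (lowerPart θ p) (upperPart θ p) (x.1 (θ.toOrderHom p)), by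
    intro p hp
    have hle : (θ.toOrderHom ⟨p, by omega⟩).1 ≤ (θ.toOrderHom ⟨p + 1, by omega⟩).1 :=
      θ.toOrderHom.monotone p.le_succ
    have key := codiag_compat X n.len x _ _ hle
      (Nat.le_of_lt_succ (θ.toOrderHom ⟨p + 1, by omega⟩).2)
    have e1 : finalIncl m.len p (p + 1) p.le_succ hp ≫ upperPart θ ⟨p, by omega⟩ =
        upperPart θ ⟨p + 1, by omega⟩ ≫ finalIncl n.len _ _ hle
          (Nat.le_of_lt_succ (θ.toOrderHom ⟨p + 1, by omega⟩).2) := by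
      ext i : 3
      apply Fin.ext
      have hi : p + 1 + i.1 < m.len + 1 := by
        have := i.2
        simp only [SimplexCategory.len_mk] at this
        omega
      have hm : (θ.toOrderHom ⟨p + 1, by omega⟩).1 ≤ (θ.toOrderHom ⟨p + 1 + i.1, hi⟩).1 :=
        θ.toOrderHom.monotone (show p + 1 ≤ p + 1 + i.1 by omega)
      have hq : (⟨p + (i.1 + (p + 1 - p)), by omega⟩ : Fin (m.len + 1)) =
        ⟨p + 1 + i.1, hi⟩ := Fin.ext (by simp; omega)
      change (θ.toOrderHom ⟨p + (i.1 + (p + 1 - p)), _⟩).1 - (θ.toOrderHom ⟨p, _⟩).1 =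
        ((θ.toOrderHom ⟨p + 1 + i.1, _⟩).1 - (θ.toOrderHom ⟨p + 1, _⟩).1) +
          ((θ.toOrderHom ⟨p + 1, _⟩).1 - (θ.toOrderHom ⟨p, _⟩).1)
      rw [hq]
      omega
    have e2 : initialIncl p (p + 1) p.le_succ ≫ lowerPart θ ⟨p + 1, by omega⟩ =
        lowerPart θ ⟨p, by omega⟩ ≫ initialIncl _ _ hle := rfl
    calc _ = biMap X (lowerPart θ ⟨p, by omega⟩) (upperPart θ ⟨p + 1, by omega⟩)
          (biMap X (𝟙 _) (finalIncl n.len _ _ hle _) (x.1 (θ.toOrderHom ⟨p, by omega⟩))) := by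
            rw [biMap_biMap, biMap_biMap, e1]
            simp only [Category.id_comp, Category.comp_id]
      _ = _ := by
            refine (congrArg _ key).trans ?_
            rw [biMap_biMap, biMap_biMap, e2]
            simp only [Category.id_comp, Category.comp_id]⟩
  map_one' := Subtype.ext (funext fun p => map_one (biMap X (lowerPart θ p) (upperPart θ p)))
  map_mul' x y := Subtype.ext (funext fun p =>
    map_mul (biMap X (lowerPart θ p) (upperPart θ p)) _ _)

/-- The Artin–Mazur codiagonal `∇X` of a bisimplicial group. -/
def codiagonal : SimplicialGroup.{u} where
  obj n := GrpCat.of (codiagSubgroup X n.unop.len)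
  map θ := GrpCat.ofHom (codiagMap X θ.unop)
  map_id n := by
    refine GrpCat.ext fun x => Subtype.ext (funext fun p => ?_)
    have e1 : lowerPart (𝟙 n.unop) p = 𝟙 _ := rfl
    have e2 : upperPart (𝟙 n.unop) p = 𝟙 _ := by
      ext i : 3
      apply Fin.ext
      change p.1 + i.1 - p.1 = i.1
      omega
    change biMap X (lowerPart (𝟙 n.unop) p) (upperPart (𝟙 n.unop) p) (x.1 p) = x.1 p
    rw [e1, e2]
    exact ConcreteCategory.congr_hom (X.map_id (op (⦋p.1⦌, ⦋n.unop.len - p.1⦌))) (x.1 p)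
  map_comp {a b c} f g := by
    refine GrpCat.ext fun x => Subtype.ext (funext fun p => ?_)
    have e2 : upperPart (g.unop ≫ f.unop) p =
        upperPart g.unop p ≫ upperPart f.unop (g.unop.toOrderHom p) := by
      ext i : 3
      apply Fin.ext
      have hi : p.1 + i.1 < c.unop.len + 1 := by
        have := i.2
        have := p.2
        simp only [SimplexCategory.len_mk] at *
        omega
      have hm : (g.unop.toOrderHom p).1 ≤ (g.unop.toOrderHom ⟨p.1 + i.1, hi⟩).1 :=
        g.unop.toOrderHom.monotone (show p.1 ≤ p.1 + i.1 by omega)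
      have hlt := (g.unop.toOrderHom ⟨p.1 + i.1, hi⟩).2
      have hq : (⟨(g.unop.toOrderHom p).1 + ((g.unop.toOrderHom ⟨p.1 + i.1, hi⟩).1 -
        (g.unop.toOrderHom p).1), by omega⟩ : Fin (b.unop.len + 1)) =
        g.unop.toOrderHom ⟨p.1 + i.1, hi⟩ := Fin.ext (by simp; omega)
      change (f.unop.toOrderHom (g.unop.toOrderHom ⟨p.1 + i.1, hi⟩)).1 - _ =
        (f.unop.toOrderHom ⟨(g.unop.toOrderHom p).1 + ((g.unop.toOrderHom ⟨p.1 + i.1, hi⟩).1 -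
        (g.unop.toOrderHom p).1), _⟩).1 - _
      rw [hq]
      rfl
    change biMap X (lowerPart (g.unop ≫ f.unop) p) (upperPart (g.unop ≫ f.unop) p) _ =
      biMap X (lowerPart g.unop p) (upperPart g.unop p)
        (biMap X (lowerPart f.unop (g.unop.toOrderHom p))
          (upperPart f.unop (g.unop.toOrderHom p)) _)
    rw [biMap_biMap, e2]
    rfl

end Codiagonal

/-! ### Cat¹-groups, cat²-groups and their nerves -/

/-- `(G, s, t)` is a cat¹-group. -/
structure IsCat1 {G : Type u} [Group G] (s t : G →* G) : Prop where
  s_t : ∀ x, s (t x) = t x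
  t_s : ∀ x, t (s x) = s x
  commute : ∀ x y, s x = 1 → t y = 1 → x * y = y * x

/-- A cat²-group: a group with two independent cat¹-group structures. -/
structure Cat2Group where
  G : Type u
  [group : Group G]
  s₁ : G →* G
  t₁ : G →* G
  s₂ : G →* G
  t₂ : G →* G
  isCat1₁ : IsCat1 s₁ t₁
  isCat1₂ : IsCat1 s₂ t₂
  s_s : ∀ x, s₁ (s₂ x) = s₂ (s₁ x)
  t_t : ∀ x, t₁ (t₂ x) = t₂ (t₁ x)
  s_t : ∀ x, s₁ (t₂ x) = t₂ (s₁ x)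
  t_s : ∀ x, t₁ (s₂ x) = s₂ (t₁ x)

attribute [instance] Cat2Group.group

section Nerve

/-- The pairs `i ≤ j` in `[n]`, i.e. the morphisms of `[n]` regarded as a category. -/
abbrev OrdArrow (n : SimplexCategory) : Type :=
  {a : Fin (n.len + 1) × Fin (n.len + 1) // a.1 ≤ a.2}

/-- The morphism `i ≤ j`. -/
abbrev ordArrow {n : SimplexCategory} (i j : Fin (n.len + 1)) (h : i ≤ j) : OrdArrow n :=
  ⟨(i, j), h⟩

/-- The action of a monotone map on morphisms. -/
def OrdArrow.map {m n : SimplexCategory} (θ : m ⟶ n) (a : OrdArrow m) : OrdArrow n :=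
  ordArrow (θ.toOrderHom a.1.1) (θ.toOrderHom a.1.2) (θ.toOrderHom.monotone a.2)

/-- A cat¹-group `(G, s, t)` is an internal groupoid: elements of `G` are morphisms, `s` and `t`
send a morphism to (the identity of) its source and target, and the composite of `x` followed by
`y`, where `t x = s y`, is `y (s y)⁻¹ x`. A family of elements of `G` indexed by the morphisms
of `[n]` is functorial if it is a functor from `[n]` to this groupoid. -/
structure IsFunctorial {G : Type u} [Group G] (s t : G →* G) {n : SimplexCategory}
    (x : OrdArrow n → G) : Prop where
  source : ∀ i j (h : i ≤ j), s (x (ordArrow i j h)) = x (ordArrow i i le_rfl)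
  target : ∀ i j (h : i ≤ j), t (x (ordArrow i j h)) = x (ordArrow j j le_rfl)
  comp : ∀ i j k (h : i ≤ j) (h' : j ≤ k), x (ordArrow i k (h.trans h')) =
    x (ordArrow j k h') * (x (ordArrow j j le_rfl))⁻¹ * x (ordArrow i j h)

variable {G : Type u} [Group G] {s t : G →* G} {n : SimplexCategory}

theorem IsFunctorial.one : IsFunctorial s t (1 : OrdArrow n → G) :=
  ⟨fun _ _ _ => map_one s, fun _ _ _ => map_one t, fun _ _ _ _ _ => by simp⟩

theorem IsFunctorial.mul (hG : IsCat1 s t) {x y : OrdArrow n → G} (hx : IsFunctorial s t x)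
    (hy : IsFunctorial s t y) : IsFunctorial s t (x * y) where
  source i j h := by simp only [Pi.mul_apply, map_mul, hx.source, hy.source]
  target i j h := by simp only [Pi.mul_apply, map_mul, hx.target, hy.target]
  comp i j k h h' := by
    simp only [Pi.mul_apply]
    rw [hx.comp i j k h h', hy.comp i j k h h']
    have h1 : s (y (ordArrow j k h') * (y (ordArrow j j le_rfl))⁻¹) = 1 := by
      rw [map_mul, map_inv, hy.source, hy.source, mul_inv_cancel]
    have h2 : t ((x (ordArrow j j le_rfl))⁻¹ * x (ordArrow i j h)) = 1 := by
      rw [map_mul, map_inv, hx.target, hx.target, inv_mul_cancel]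
    have h3 := hG.commute _ _ h1 h2
    calc _ = x (ordArrow j k h') * (((x (ordArrow j j le_rfl))⁻¹ * x (ordArrow i j h)) *
          (y (ordArrow j k h') * (y (ordArrow j j le_rfl))⁻¹)) * y (ordArrow i j h) := by group
      _ = _ := by rw [← h3]; group

theorem IsFunctorial.inv (hG : IsCat1 s t) {x : OrdArrow n → G} (hx : IsFunctorial s t x) :
    IsFunctorial s t x⁻¹ where
  source i j h := by simp only [Pi.inv_apply, map_inv, hx.source]
  target i j h := by simp only [Pi.inv_apply, map_inv, hx.target]
  comp i j k h h' := by
    simp only [Pi.inv_apply]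
    rw [hx.comp i j k h h']
    have h1 : s (x (ordArrow j k h') * (x (ordArrow j j le_rfl))⁻¹) = 1 := by
      rw [map_mul, map_inv, hx.source, hx.source, mul_inv_cancel]
    have h2 : t (x (ordArrow i j h) * (x (ordArrow j j le_rfl))⁻¹) = 1 := by
      rw [map_mul, map_inv, hx.target, hx.target, mul_inv_cancel]
    have h3 := hG.commute _ _ h1 h2
    calc _ = (x (ordArrow j j le_rfl))⁻¹ * ((x (ordArrow j k h') * (x (ordArrow j j le_rfl))⁻¹) *
          (x (ordArrow i j h) * (x (ordArrow j j le_rfl))⁻¹))⁻¹ := by group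
      _ = _ := by rw [h3]; group

theorem IsFunctorial.map {m : SimplexCategory} {x : OrdArrow n → G} (hx : IsFunctorial s t x)
    (θ : m ⟶ n) : IsFunctorial s t (fun a => x (OrdArrow.map θ a)) where
  source _ _ h := hx.source _ _ (θ.toOrderHom.monotone h)
  target _ _ h := hx.target _ _ (θ.toOrderHom.monotone h)
  comp _ _ _ h h' := hx.comp _ _ _ (θ.toOrderHom.monotone h) (θ.toOrderHom.monotone h')

end Nerve

namespace Cat2Group

variable (C : Cat2Group.{u})

/-- The group of `(p, q)`-simplices of the binerve: families of elements of the big group indexed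
by pairs of morphisms of `[p]` and of `[q]`, functorial in the first variable for the first
internal groupoid structure and in the second variable for the second one. -/
def binerveSubgroup (p q : SimplexCategory) : Subgroup (OrdArrow p → OrdArrow q → C.G) where
  carrier := {x | (∀ b, IsFunctorial C.s₁ C.t₁ fun a => x a b) ∧
    ∀ a, IsFunctorial C.s₂ C.t₂ fun b => x a b}
  one_mem' := ⟨fun _ => IsFunctorial.one, fun _ => IsFunctorial.one⟩
  mul_mem' hx hy := ⟨fun b => (hx.1 b).mul C.isCat1₁ (hy.1 b),
    fun a => (hx.2 a).mul C.isCat1₂ (hy.2 a)⟩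
  inv_mem' hx := ⟨fun b => (hx.1 b).inv C.isCat1₁, fun a => (hx.2 a).inv C.isCat1₂⟩

/-- The bisimplicial group obtained by taking the nerve of a cat²-group (a double groupoid
internal to groups) in both directions. -/
def binerve : BisimplicialGroup.{u} where
  obj a := GrpCat.of (C.binerveSubgroup a.unop.1 a.unop.2)
  map f := GrpCat.ofHom
    { toFun := fun x => ⟨fun i j => x.1 (OrdArrow.map f.unop.1 i) (OrdArrow.map f.unop.2 j),
        fun _ => (x.2.1 _).map f.unop.1, fun _ => (x.2.2 _).map f.unop.2⟩
      map_one' := rfl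
      map_mul' := fun _ _ => rfl }
  map_id _ := rfl
  map_comp _ _ := rfl

end Cat2Group

/-! ### Crossed modules and crossed squares -/

/-- `φ : A → B` with the action `act` of `B` on `A` is a crossed module. -/
structure IsCrossedModule {A B : Type u} [Group A] [Group B] (φ : A →* B)
    (act : B →* MulAut A) : Prop where
  equivariant : ∀ b a, φ (act b a) = b * φ a * b⁻¹
  peiffer : ∀ a a', act (φ a) a' = a * a' * a⁻¹

/-- A crossed square
```
  L --lam--> M
  |          |
 lam'        mu
  v          v
  N --nu---> P
```
The actions of `M` and of `N` on the other groups are via `mu` and `nu`. -/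
structure CrossedSquare where
  L : Type u
  M : Type u
  N : Type u
  P : Type u
  [groupL : Group L]
  [groupM : Group M]
  [groupN : Group N]
  [groupP : Group P]
  lam : L →* M
  lam' : L →* N
  mu : M →* P
  nu : N →* P
  actL : P →* MulAut L
  actM : P →* MulAut M
  actN : P →* MulAut N
  h : M → N → L
  comm : ∀ l, mu (lam l) = nu (lam' l)
  crossed_lam : IsCrossedModule lam (actL.comp mu)
  crossed_lam' : IsCrossedModule lam' (actL.comp nu)
  crossed_mu : IsCrossedModule mu actM
  crossed_nu : IsCrossedModule nu actN
  crossed_kappa : IsCrossedModule (mu.comp lam) actL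
  lam_act : ∀ p l, lam (actL p l) = actM p (lam l)
  lam'_act : ∀ p l, lam' (actL p l) = actN p (lam' l)
  lam_h : ∀ m n, lam (h m n) = m * actM (nu n) m⁻¹
  lam'_h : ∀ m n, lam' (h m n) = actN (mu m) n * n⁻¹
  h_lam : ∀ l n, h (lam l) n = l * actL (nu n) l⁻¹
  h_lam' : ∀ m l, h m (lam' l) = actL (mu m) l * l⁻¹
  h_mul_left : ∀ m m' n, h (m * m') n = actL (mu m) (h m' n) * h m n
  h_mul_right : ∀ m n n', h m (n * n') = h m n * actL (nu n) (h m n')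
  h_act : ∀ p m n, h (actM p m) (actN p n) = actL p (h m n)

attribute [instance] CrossedSquare.groupL CrossedSquare.groupM CrossedSquare.groupN
  CrossedSquare.groupP

/-- The homomorphism to the automorphism group given by an action by endomorphisms. -/
def autOfAction {A B : Type u} [Group A] [Group B] (f : B → A →* A) (h1 : ∀ a, f 1 a = a)
    (hmul : ∀ b b' a, f (b * b') a = f b (f b' a)) : B →* MulAut A where
  toFun b :=
    { toFun := f b
      invFun := f b⁻¹
      left_inv := fun a => by rw [← hmul, inv_mul_cancel, h1]
      right_inv := fun a => by rw [← hmul, mul_inv_cancel, h1]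
      map_mul' := map_mul (f b) }
  map_one' := MulEquiv.ext h1
  map_mul' b b' := MulEquiv.ext (hmul b b')

namespace CrossedSquare

variable (S : CrossedSquare.{u})

/-- `L ⋊ N`, where `N` acts on `L` via `P`. -/
abbrev LN : Type u := S.L ⋊[S.actL.comp S.nu] S.N

/-- `M ⋊ P`. -/
abbrev MP : Type u := S.M ⋊[S.actM] S.P

theorem h_one_right (m : S.M) : S.h m 1 = 1 := by
  have := S.h_lam' m 1
  simpa using this

theorem h_one_left (n : S.N) : S.h 1 n = 1 := by
  have := S.h_lam 1 n
  simpa using this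

theorem actL_mu_nu (m : S.M) (n : S.N) (l : S.L) :
    S.actL (S.mu m) (S.actL (S.nu n) l) * S.h m n =
      S.h m n * S.actL (S.nu n) (S.actL (S.mu m) l) := by
  have hp : S.mu (S.lam (S.h m n)) * S.nu n * S.mu m = S.mu m * S.nu n := by
    rw [S.lam_h, map_mul, S.crossed_mu.equivariant, map_inv]
    group
  have h1 := S.crossed_kappa.peiffer (S.h m n) (S.actL (S.nu n) (S.actL (S.mu m) l))
  rw [MonoidHom.comp_apply, ← MulAut.mul_apply, ← MulAut.mul_apply, ← map_mul, ← map_mul, hp,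
    map_mul, MulAut.mul_apply] at h1
  rw [h1]
  simp

/-- The endomorphism `(l, n) ↦ (^{μ(m)p} l h(m, ^p n), ^p n)` of `L ⋊ N` given by
`(m, p) ∈ M ⋊ P`. -/
def actLNHom (x : S.MP) : S.LN →* S.LN where
  toFun y := ⟨S.actL (S.mu x.left * x.right) y.left * S.h x.left (S.actN x.right y.right),
    S.actN x.right y.right⟩
  map_one' := by
    ext <;> simp [h_one_right]
  map_mul' y z := by
    have key (p : S.P) (n : S.N) (l : S.L) :
        S.actL p (S.actL (S.nu n) l) = S.actL (S.nu (S.actN p n)) (S.actL p l) := by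
      rw [S.crossed_nu.equivariant, ← MulAut.mul_apply, ← MulAut.mul_apply, ← map_mul, ← map_mul]
      congr 2
      group
    ext
    · simp only [SemidirectProduct.mul_left, SemidirectProduct.mul_right, MonoidHom.comp_apply,
        map_mul, MulAut.mul_apply, S.h_mul_right, key x.right]
      have h1 := S.actL_mu_nu x.left (S.actN x.right y.right) (S.actL x.right z.left)
      simp only [mul_assoc]
      congr 1
      rw [← mul_assoc, h1, mul_assoc]
    · simp

/-- The action of `M ⋊ P` on `L ⋊ N`. -/
def actLN : S.MP →* MulAut S.LN :=
  autOfAction S.actLNHom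
    (fun y => by ext <;> simp [actLNHom, h_one_left])
    (fun x x' y => by
      ext
      · simp only [actLNHom, MonoidHom.coe_mk, OneHom.coe_mk, SemidirectProduct.mul_left,
          SemidirectProduct.mul_right, map_mul, MulAut.mul_apply, S.h_mul_left, S.h_act,
          S.crossed_mu.equivariant, map_inv]
        simp only [mul_assoc]
        congr 1
        simp only [MulAut.inv_apply_self]
      · simp [actLNHom])

/-- The homomorphism `(λ, ν) : L ⋊ N → M ⋊ P`. -/
def bdry : S.LN →* S.MP where
  toFun y := ⟨S.lam y.left, S.nu y.right⟩
  map_one' := by ext <;> simp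
  map_mul' y z := by ext <;> simp [S.lam_act]

theorem actLN_apply (x : S.MP) (y : S.LN) : S.actLN x y =
    ⟨S.actL (S.mu x.left * x.right) y.left * S.h x.left (S.actN x.right y.right),
      S.actN x.right y.right⟩ := rfl

theorem crossed_bdry : IsCrossedModule S.bdry S.actLN where
  equivariant x y := by
    rw [actLN_apply]
    ext
    · simp only [bdry, MonoidHom.coe_mk, OneHom.coe_mk, map_mul, S.lam_act, S.lam_h,
        SemidirectProduct.mul_left, SemidirectProduct.inv_left, SemidirectProduct.mul_right,
        MulAut.mul_apply, S.crossed_mu.peiffer, S.crossed_nu.equivariant, map_inv]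
      simp only [mul_assoc, inv_mul_cancel_left]
    · simp [bdry, S.crossed_nu.equivariant]
  peiffer y z := by
    rw [actLN_apply]
    ext
    · simp only [bdry, MonoidHom.coe_mk, OneHom.coe_mk,
        SemidirectProduct.mul_left, SemidirectProduct.inv_left, SemidirectProduct.mul_right,
        MulAut.mul_apply, map_inv, S.h_lam, MonoidHom.comp_apply, map_mul]
      have h1 := S.crossed_kappa.peiffer y.left (S.actL (S.nu y.right) z.left)
      rw [MonoidHom.comp_apply] at h1
      rw [h1, S.crossed_nu.equivariant]
      simp [mul_assoc]
    · simp [bdry, S.crossed_nu.peiffer]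

/-- The big group `(L ⋊ N) ⋊ (M ⋊ P)` of the cat²-group of a crossed square. -/
abbrev Big : Type u := S.LN ⋊[S.actLN] S.MP

/-- `((l, n), (m, p)) ↦ ((1, 1), (m, p))`. -/
def s₁ : S.Big →* S.Big where
  toFun x := ⟨1, x.right⟩
  map_one' := rfl
  map_mul' x y := by ext : 1 <;> simp

/-- `((l, n), (m, p)) ↦ ((1, 1), (λ l, ν n) (m, p))`. -/
def t₁ : S.Big →* S.Big where
  toFun x := ⟨1, S.bdry x.left * x.right⟩
  map_one' := by ext : 1 <;> simp
  map_mul' x y := by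
    ext : 1
    · simp
    · simp [S.crossed_bdry.equivariant, mul_assoc]

/-- `((l, n), (m, p)) ↦ ((1, n), (1, p))`. -/
def s₂ : S.Big →* S.Big where
  toFun x := ⟨⟨1, x.left.right⟩, ⟨1, x.right.right⟩⟩
  map_one' := rfl
  map_mul' x y := by
    ext <;> simp [actLN_apply, h_one_left]

/-- `((l, n), (m, p)) ↦ ((1, λ'(l) n), (1, μ(m) p))`. -/
def t₂ : S.Big →* S.Big where
  toFun x := ⟨⟨1, S.lam' x.left.left * x.left.right⟩, ⟨1, S.mu x.right.left * x.right.right⟩⟩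
  map_one' := by ext <;> simp
  map_mul' x y := by
    ext
    · simp [actLN_apply, h_one_left]
    · simp [actLN_apply, S.lam'_act, S.lam'_h, S.crossed_nu.peiffer, mul_assoc]
    · simp
    · simp [S.crossed_mu.equivariant, mul_assoc]

/-- The cat²-group associated with a crossed square. The first structure is in the direction of
`L → M` and `N → P`, the second in the direction of `L → N` and `M → P`. -/
def toCat2Group : Cat2Group.{u} where
  G := S.Big
  s₁ := S.s₁
  t₁ := S.t₁
  s₂ := S.s₂
  t₂ := S.t₂
  isCat1₁ :=
    { s_t := fun x => rfl
      t_s := fun x => by ext : 1 <;> simp [s₁, t₁]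
      commute := fun x y hx hy => by
        have hx' : x.right = 1 := congrArg SemidirectProduct.right hx
        have hy' : S.bdry y.left * y.right = 1 := congrArg SemidirectProduct.right hy
        rw [mul_eq_one_iff_inv_eq] at hy'
        have h1 := S.crossed_bdry.peiffer y.left⁻¹ x.left
        ext : 1
        · rw [SemidirectProduct.mul_left, SemidirectProduct.mul_left, hx', ← hy', ← map_inv, h1]
          simp [mul_assoc]
        · rw [SemidirectProduct.mul_right, SemidirectProduct.mul_right, hx', one_mul, mul_one] }
  isCat1₂ :=
    { s_t := fun x => rfl
      t_s := fun x => by ext <;> simp [s₂, t₂]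
      commute := fun x y hx hy => by
        have hn : x.left.right = 1 := congrArg (fun z => z.left.right) hx
        have hp : x.right.right = 1 := congrArg (fun z => z.right.right) hx
        have hn' : S.lam' y.left.left * y.left.right = 1 := congrArg (fun z => z.left.right) hy
        have hp' : S.mu y.right.left * y.right.right = 1 := congrArg (fun z => z.right.right) hy
        have hn2 : y.left.right = S.lam' y.left.left⁻¹ := by
          rw [map_inv]; exact (inv_eq_of_mul_eq_one_right hn').symm
        have hp2 : y.right.right = S.mu y.right.left⁻¹ := by
          rw [map_inv]; exact (inv_eq_of_mul_eq_one_right hp').symm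
        have h1 := S.crossed_mu.peiffer y.right.left⁻¹ x.right.left
        have h2 := S.crossed_lam'.peiffer y.left.left⁻¹ x.left.left
        have h3 := S.h_lam' x.right.left y.left.left⁻¹
        rw [← hp2] at h1
        rw [← hn2] at h2 h3
        ext
        · simp only [SemidirectProduct.mul_left, actLN_apply, hn, hp, hp',
            map_one, mul_one, MulAut.one_apply, h_one_right, h2, h3]
          simp [mul_assoc]
        · simp [actLN_apply, hn, hp]
        · simp [hp, h1, mul_assoc]
        · simp [hp] }
  s_s x := by ext <;> simp [s₁, s₂]
  t_t x := by ext <;> simp [t₁, t₂, bdry, S.comm, mul_assoc, S.crossed_mu.equivariant]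
  s_t x := by ext <;> simp [s₁, t₂]
  t_s x := by ext <;> simp [t₁, s₂, bdry]

/-- The bisimplicial nerve of a crossed square. -/
def binerve : BisimplicialGroup.{u} := S.toCat2Group.binerve

/-- `M ⋊ N`, where `N` acts on `M` via `P`. -/
abbrev MN : Type u := S.M ⋊[S.actM.comp S.nu] S.N

/-- `∂₁ (m, n) = μ(m) ν(n)`. -/
def mapD₁ : S.MN →* S.P where
  toFun x := S.mu x.left * S.nu x.right
  map_one' := by simp
  map_mul' x y := by simp [S.crossed_mu.equivariant, mul_assoc]

/-- `∂₂ l = (λ(l)⁻¹, λ'(l))`. -/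
def mapD₂ : S.L →* S.MN where
  toFun l := ⟨(S.lam l)⁻¹, S.lam' l⟩
  map_one' := by ext <;> simp
  map_mul' k l := by
    ext
    · simp [← S.comm, S.crossed_mu.peiffer, mul_assoc]
    · simp

/-- The groups `P`, `M ⋊ N`, `L`, `1`, `1`, … of the mapping complex. -/
def mapX : ℕ → Type u
  | 0 => S.P
  | 1 => S.MN
  | 2 => S.L
  | _ + 3 => PUnit

instance mapXGroup : (n : ℕ) → Group (S.mapX n)
  | 0 => inferInstanceAs (Group S.P)
  | 1 => inferInstanceAs (Group S.MN)
  | 2 => inferInstanceAs (Group S.L)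
  | _ + 3 => inferInstanceAs (Group PUnit)

/-- The differentials of the mapping complex. -/
def mapD : (n : ℕ) → S.mapX (n + 1) →* S.mapX n
  | 0 => S.mapD₁
  | 1 => S.mapD₂
  | _ + 2 => 1

theorem mapD₁_mapD₂ (l : S.L) : S.mapD₁ (S.mapD₂ l) = 1 := by
  simp [mapD₁, mapD₂, ← S.comm]

theorem mapD₁_range_normal : S.mapD₁.range.Normal := by
  refine ⟨?_⟩
  rintro _ ⟨x, rfl⟩ p
  refine ⟨⟨S.actM p x.left, S.actN p x.right⟩, ?_⟩
  change S.mu (S.actM p x.left) * S.nu (S.actN p x.right) =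
    p * (S.mu x.left * S.nu x.right) * p⁻¹
  rw [S.crossed_mu.equivariant, S.crossed_nu.equivariant]
  group

theorem mapD₂_range_normal : S.mapD₂.range.Normal := by
  refine ⟨?_⟩
  rintro _ ⟨l, rfl⟩ y
  refine ⟨S.actL (S.nu y.right) l, ?_⟩
  have h1 := S.crossed_mu.peiffer (S.lam (S.actL (S.nu y.right) l)) y.left⁻¹
  have h2 : S.nu y.right * S.nu (S.lam' l) * (S.nu y.right)⁻¹ =
      S.mu (S.lam (S.actL (S.nu y.right) l)) := by
    rw [S.comm, S.lam'_act, S.crossed_nu.equivariant]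
  rw [← h2] at h1
  ext
  · simp only [mapD₂, MonoidHom.coe_mk, OneHom.coe_mk, SemidirectProduct.mul_left,
      SemidirectProduct.mul_right, SemidirectProduct.inv_left, MonoidHom.comp_apply, map_mul,
      MulAut.mul_apply, map_inv, S.lam_act] at h1 ⊢
    rw [h1]
    group
  · simp [mapD₂, S.lam'_act, S.crossed_nu.peiffer]

/-- The mapping complex `L → M ⋊ N → P` of a crossed square, trivial in degrees `≥ 3`. -/
def mappingComplex : NormalComplex.{u} where
  X := S.mapX
  d := S.mapD
  d_comp_d
    | 0, l => S.mapD₁_mapD₂ l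
    | n + 1, _ => map_one (S.mapD (n + 1))
  normal_range
    | 0 => S.mapD₁_range_normal
    | 1 => S.mapD₂_range_normal
    | n + 2 => (MonoidHom.range_one : (1 : S.mapX (n + 3) →* S.mapX (n + 2)).range = ⊥) ▸
        inferInstance

end CrossedSquare

/-! ### The crossed square `𝔐(G, 2)` of a simplicial group -/

section SquareOf

variable (G : SimplicialGroup.{u})

/-- The group `G_n` of a simplicial group. -/
abbrev level (n : ℕ) : Type u := G.obj (op (SimplexCategory.mk n))

/-- `NG₂ / ∂₃ NG₃`. -/
abbrev topQuot : Type u := moore G 2 ⧸ (mooreD G 2).range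

instance mooreD_range_normal (n : ℕ) : (mooreD G n).range.Normal :=
  (mooreComplex G).normal_range n

/-- `∂₃ NG₃` as a subgroup of `G₂`. -/
def topBdry : Subgroup (level G 2) := (mooreD G 2).range.map (moore G 2).subtype

theorem mem_topBdry (x : level G 2) :
    x ∈ topBdry G ↔ ∃ z ∈ moore G 3, face G 2 3 z = x := by
  constructor
  · rintro ⟨_, ⟨z, rfl⟩, rfl⟩
    exact ⟨z, z.2, rfl⟩
  · rintro ⟨z, hz, rfl⟩
    exact ⟨mooreD G 2 ⟨z, hz⟩, ⟨_, rfl⟩, rfl⟩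

instance topBdry_normal : (topBdry G).Normal := by
  refine ⟨fun x hx g => ?_⟩
  obtain ⟨z, hz, rfl⟩ := (mem_topBdry G x).1 hx
  obtain ⟨w, hw⟩ := conj_face_last G 2 g ⟨z, hz⟩
  exact (mem_topBdry G _).2 ⟨w, w.2, hw⟩

theorem mem_moore_two (x : level G 2) :
    x ∈ moore G 2 ↔ face G 1 0 x = 1 ∧ face G 1 1 x = 1 := by
  rw [mem_moore_succ, Fin.forall_fin_two]
  rfl

theorem mem_moore_three (x : level G 3) :
    x ∈ moore G 3 ↔ face G 2 0 x = 1 ∧ face G 2 1 x = 1 ∧ face G 2 2 x = 1 := by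
  rw [mem_moore_succ, Fin.forall_fin_succ, Fin.forall_fin_two]
  rfl

theorem topQuot_mk_eq (x y : moore G 2) :
    (x : topQuot G) = y ↔
      (QuotientGroup.mk (x : level G 2) : level G 2 ⧸ topBdry G) = QuotientGroup.mk y.1 := by
  rw [QuotientGroup.eq, QuotientGroup.eq, topBdry]
  constructor
  · intro h
    exact ⟨_, h, rfl⟩
  · rintro ⟨w, hw, e⟩
    have : w = x⁻¹ * y := Subtype.ext e
    exact this ▸ hw

/-- A commutator of the form `d₃ [a, w]` with `[a, w] ∈ NG₃` is trivial modulo `∂₃ NG₃`. -/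
theorem commute_of_lift (a w : level G 3)
    (h0 : face G 2 0 a = 1 ∨ face G 2 0 w = 1) (h1 : face G 2 1 a = 1 ∨ face G 2 1 w = 1)
    (h2 : face G 2 2 a = 1 ∨ face G 2 2 w = 1) :
    Commute (QuotientGroup.mk (face G 2 3 a) : level G 2 ⧸ topBdry G)
      (QuotientGroup.mk (face G 2 3 w)) := by
  have aux : ∀ i : Fin 4, (face G 2 i a = 1 ∨ face G 2 i w = 1) → face G 2 i (a * w * a⁻¹ * w⁻¹) = 1 := by
    intro i h
    simp only [map_mul, map_inv]
    rcases h with h | h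
    · rw [h]; simp
    · rw [h]; simp
  have hz : (a * w * a⁻¹ * w⁻¹) ∈ moore G 3 := (mem_moore_three G _).2 ⟨aux 0 h0, aux 1 h1, aux 2 h2⟩
  have h := (QuotientGroup.eq_one_iff (N := topBdry G) _).2
    ((mem_topBdry G _).2 ⟨_, hz, rfl⟩)
  simp only [map_mul, map_inv, QuotientGroup.mk_mul, QuotientGroup.mk_inv] at h
  rwa [mul_inv_eq_one, mul_inv_eq_iff_eq_mul] at h

theorem commute_zero_onetwo (a k : level G 2) (ha : face G 1 0 a = 1) (hk1 : face G 1 1 k = 1)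
    (hk2 : face G 1 2 k = 1) :
    Commute (QuotientGroup.mk a : level G 2 ⧸ topBdry G) (QuotientGroup.mk k) := by
  have d3 := face_degen_succ G 2 2 a
  have d3' := face_degen_succ G 2 2 k
  have h31 := face_degen_gt G 1 2 1 (by decide) k
  have h30 := face_degen_gt G 1 2 0 (by decide) k
  have h12 := face_degen_le G 1 1 1 (by decide) k
  have h11 := face_degen_self G 2 1 k
  have h10 := face_degen_succ G 2 0 k
  have h22 := face_degen_self G 2 2 k
  have h21 := face_degen_succ G 2 1 k
  have h20 := face_degen_gt G 1 1 0 (by decide) k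
  have h02 := face_degen_le G 1 0 1 (by decide) a
  have := commute_of_lift G (degen G 2 2 a)
    (degen G 2 2 k * (degen G 2 1 k)⁻¹ * degen G 2 0 k)
    (Or.inl (h02.trans (by rw [ha, map_one])))
    (Or.inr (by
      rw [map_mul, map_mul, map_inv]
      refine (congrArg₂ _ (congrArg₂ _ h12 (congrArg _ h11)) h10).trans ?_
      rw [hk1]; simp))
    (Or.inr (by
      rw [map_mul, map_mul, map_inv]
      refine (congrArg₂ _ (congrArg₂ _ h22 (congrArg _ h21)) h20).trans ?_
      rw [hk1]; simp))
  have e : face G 2 3 (degen G 2 2 k * (degen G 2 1 k)⁻¹ * degen G 2 0 k) = k := by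
    rw [map_mul, map_mul, map_inv]
    refine (congrArg₂ _ (congrArg₂ _ d3' (congrArg _ h31)) h30).trans ?_
    rw [hk2]; simp
  rw [e] at this
  exact d3 ▸ this

theorem commute_one_zerotwo (a k : level G 2) (ha : face G 1 1 a = 1) (hk0 : face G 1 0 k = 1)
    (hk2 : face G 1 2 k = 1) :
    Commute (QuotientGroup.mk a : level G 2 ⧸ topBdry G) (QuotientGroup.mk k) := by
  have d3 := face_degen_succ G 2 2 a
  have d3' := face_degen_succ G 2 2 k
  have h31 := face_degen_gt G 1 2 1 (by decide) k
  have h02 := face_degen_le G 1 0 1 (by decide) k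
  have h01 := face_degen_le G 1 0 0 (by decide) k
  have h22 := face_degen_self G 2 2 k
  have h21 := face_degen_succ G 2 1 k
  have h12 := face_degen_le G 1 1 1 (by decide) a
  have := commute_of_lift G (degen G 2 2 a) (degen G 2 2 k * (degen G 2 1 k)⁻¹)
    (Or.inr (by
      rw [map_mul, map_inv]
      refine (congrArg₂ _ h02 (congrArg _ h01)).trans ?_
      rw [hk0]; simp))
    (Or.inl (h12.trans (by rw [ha, map_one])))
    (Or.inr (by
      rw [map_mul, map_inv]
      refine (congrArg₂ _ h22 (congrArg _ h21)).trans ?_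
      simp))
  have e : face G 2 3 (degen G 2 2 k * (degen G 2 1 k)⁻¹) = k := by
    rw [map_mul, map_inv]
    refine (congrArg₂ _ d3' (congrArg _ h31)).trans ?_
    rw [hk2]; simp
  rw [e] at this
  exact d3 ▸ this

theorem commute_two_moore (a k : level G 2) (ha : face G 1 2 a = 1) (hk : k ∈ moore G 2) :
    Commute (QuotientGroup.mk a : level G 2 ⧸ topBdry G) (QuotientGroup.mk k) := by
  obtain ⟨hk0, hk1⟩ := (mem_moore_two G k).1 hk
  have d3 := face_degen_succ G 2 2 k
  have d3' := face_degen_succ G 2 2 a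
  have h31 := face_degen_gt G 1 2 1 (by decide) a
  have h22 := face_degen_self G 2 2 a
  have h21 := face_degen_succ G 2 1 a
  have h02 := face_degen_le G 1 0 1 (by decide) k
  have h12 := face_degen_le G 1 1 1 (by decide) k
  have := commute_of_lift G (degen G 2 2 a * (degen G 2 1 a)⁻¹) (degen G 2 2 k)
    (Or.inr (h02.trans (by rw [hk0, map_one])))
    (Or.inr (h12.trans (by rw [hk1, map_one])))
    (Or.inl (by
      rw [map_mul, map_inv]
      refine (congrArg₂ _ h22 (congrArg _ h21)).trans ?_
      simp))
  have e : face G 2 3 (degen G 2 2 a * (degen G 2 1 a)⁻¹) = a := by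
    rw [map_mul, map_inv]
    refine (congrArg₂ _ d3' (congrArg _ h31)).trans ?_
    rw [ha]; simp
  rw [e] at this
  exact d3 ▸ this

/-- `d₂ : NG₂ → Ker d₀`. -/
def faceToKerZero : moore G 2 →* (face G 0 0).ker :=
  ((face G 1 2).comp (moore G 2).subtype).codRestrict _ fun x =>
    (face_face G 0 0 1 (by decide) x.1).trans
      (by rw [show face G 1 (Fin.castSucc 0) x.1 = 1 from ((mem_moore_two G x).1 x.2).1, map_one])

/-- `d₂ : NG₂ → Ker d₁`. -/
def faceToKerOne : moore G 2 →* (face G 0 1).ker :=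
  ((face G 1 2).comp (moore G 2).subtype).codRestrict _ fun x =>
    (face_face G 0 1 1 (by decide) x.1).trans
      (by rw [show face G 1 (Fin.castSucc 1) x.1 = 1 from ((mem_moore_two G x).1 x.2).2, map_one])

theorem face_two_face_three (z : moore G 3) : face G 1 2 (face G 2 3 z) = 1 :=
  (face_face G 1 2 2 (by decide) z.1).trans
    (by rw [show face G 2 (Fin.castSucc 2) z.1 = 1 from ((mem_moore_three G z).1 z.2).2.2, map_one])

/-- `NG₂ / ∂₃ NG₃ → Ker d₀`, induced by `d₂`. -/
def squareLam : topQuot G →* (face G 0 0).ker :=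
  QuotientGroup.lift _ (faceToKerZero G) (by
    rintro _ ⟨z, rfl⟩
    exact Subtype.ext (face_two_face_three G z))

/-- `NG₂ / ∂₃ NG₃ → Ker d₁`, induced by `d₂`. -/
def squareLam' : topQuot G →* (face G 0 1).ker :=
  QuotientGroup.lift _ (faceToKerOne G) (by
    rintro _ ⟨z, rfl⟩
    exact Subtype.ext (face_two_face_three G z))

/-- Conjugation by `s₁(p)` on `NG₂`. -/
def conjHom (p : level G 1) : moore G 2 →* moore G 2 where
  toFun l := ⟨degen G 1 1 p * l.1 * (degen G 1 1 p)⁻¹, (moore_normal G 2).conj_mem l.1 l.2 _⟩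
  map_one' := Subtype.ext (by simp)
  map_mul' l l' := Subtype.ext (by simp [mul_assoc])

theorem coe_conj (p : level G 1) (l : moore G 2) :
    (conjHom G p l).1 = degen G 1 1 p * l.1 * (degen G 1 1 p)⁻¹ := rfl

/-- The action of `G₁` on `NG₂ / ∂₃ NG₃` by conjugation, via `s₁ : G₁ → G₂`. -/
def squareAct : level G 1 →* MulAut (topQuot G) :=
  autOfAction
    (fun p => QuotientGroup.map _ _ (conjHom G p) (by
      rintro _ ⟨z, rfl⟩
      obtain ⟨w, hw⟩ := conj_face_last G 2 (degen G 1 1 p) z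
      exact ⟨w, Subtype.ext hw⟩))
    (fun a => by
      obtain ⟨a, rfl⟩ := QuotientGroup.mk_surjective a
      rw [QuotientGroup.map_mk]
      congr 1
      exact Subtype.ext (by simp [coe_conj]))
    (fun b b' a => by
      obtain ⟨a, rfl⟩ := QuotientGroup.mk_surjective a
      rw [QuotientGroup.map_mk, QuotientGroup.map_mk, QuotientGroup.map_mk]
      congr 1
      exact Subtype.ext (by simp [coe_conj, mul_assoc]))

/-- `s₁(y) s₀(y)⁻¹`. -/
def lift (y : level G 1) : level G 2 := degen G 1 1 y * (degen G 1 0 y)⁻¹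

theorem face_two_degen_zero (y : level G 1) (hy : face G 0 1 y = 1) :
    face G 1 2 (degen G 1 0 y) = 1 :=
  (face_degen_gt G 0 1 0 (by decide) y).trans (by rw [hy, map_one])

theorem face_zero_degen_one (x : level G 1) (hx : face G 0 0 x = 1) :
    face G 1 0 (degen G 1 1 x) = 1 :=
  (face_degen_le G 0 0 0 (by decide) x).trans (by rw [hx, map_one])

theorem face_two_degen_one (y : level G 1) : face G 1 2 (degen G 1 1 y) = y :=
  face_degen_succ G 1 1 y

theorem face_one_lift (y : level G 1) : face G 1 1 (lift G y) = 1 := by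
  rw [lift, map_mul, map_inv]
  refine (congrArg₂ _ (face_degen_self G 1 1 y)
    (congrArg _ (face_degen_succ G 1 0 y))).trans ?_
  exact mul_inv_cancel y

theorem face_two_lift (y : level G 1) (hy : face G 0 1 y = 1) : face G 1 2 (lift G y) = y := by
  rw [lift, map_mul, map_inv, face_two_degen_zero G y hy, face_two_degen_one, inv_one, mul_one]

/-- The commutator `[s₁(x), s₁(y) s₀(y)⁻¹]` for `x ∈ Ker d₀`, as an element of `NG₂`. -/
def squareComm (x : (face G 0 0).ker) (y : (face G 0 1).ker) : moore G 2 :=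
  ⟨degen G 1 1 x.1 * lift G y.1 * (degen G 1 1 x.1)⁻¹ * (lift G y.1)⁻¹, by
    rw [mem_moore_two]
    constructor
    · rw [map_mul, map_mul, map_mul, map_inv, map_inv, face_zero_degen_one G x x.2]
      simp
    · rw [map_mul, map_mul, map_mul, map_inv, map_inv, face_one_lift]
      simp⟩

/-- The `h`-map `h(x, y) = [s₁(x), s₁(y) s₀(y)⁻¹] ∂₃ NG₃`. -/
def squareH (x : (face G 0 0).ker) (y : (face G 0 1).ker) : topQuot G :=
  QuotientGroup.mk (squareComm G x y)

/-- The class modulo `∂₃ NG₃` of an element of `G₂`. -/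
abbrev cls : level G 2 →* level G 2 ⧸ topBdry G := QuotientGroup.mk' (topBdry G)

theorem topQuot_ext {x y : moore G 2} (h : cls G x.1 = cls G y.1) :
    (QuotientGroup.mk x : topQuot G) = QuotientGroup.mk y :=
  (topQuot_mk_eq G x y).2 h

/-- Modulo `∂₃ NG₃`, conjugation of an element of `Ker d₀` by an element `u` of `Ker d₁` depends
only on `d₂ u`. -/
theorem cls_conj_eq (a u v : level G 2) (ha : face G 1 0 a = 1) (hu : face G 1 1 u = 1)
    (hv : face G 1 1 v = 1) (h : face G 1 2 u = face G 1 2 v) :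
    cls G u * (cls G a)⁻¹ * (cls G u)⁻¹ = cls G v * (cls G a)⁻¹ * (cls G v)⁻¹ := by
  have hc : Commute (cls G a) (cls G (v⁻¹ * u)) := commute_zero_onetwo G a (v⁻¹ * u) ha
    (by rw [map_mul, map_inv, hu, hv]; simp) (by rw [map_mul, map_inv, h]; simp)
  have hc' := hc.inv_left.eq
  rw [map_mul, map_inv] at hc'
  have : cls G v * ((cls G a)⁻¹ * ((cls G v)⁻¹ * cls G u)) * (cls G u)⁻¹ =
      cls G v * ((cls G v)⁻¹ * cls G u * (cls G a)⁻¹) * (cls G u)⁻¹ := by rw [hc']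
  calc _ = cls G v * ((cls G v)⁻¹ * cls G u * (cls G a)⁻¹) * (cls G u)⁻¹ := by group
    _ = _ := by rw [← this]; group

theorem cls_squareComm (x : (face G 0 0).ker) (y : (face G 0 1).ker) :
    cls G (squareComm G x y).1 = cls G (degen G 1 1 x.1) *
      (cls G (lift G y.1) * (cls G (degen G 1 1 x.1))⁻¹ * (cls G (lift G y.1))⁻¹) := by
  simp only [squareComm, map_mul, map_inv, mul_assoc]

/-- The elements `u` of `Ker d₁` with `d₂ u = y` may replace `s₁(y) s₀(y)⁻¹` in the `h`-map. -/
theorem cls_squareComm_eq (x : (face G 0 0).ker) (y : (face G 0 1).ker) (u : level G 2)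
    (hu : face G 1 1 u = 1) (h : face G 1 2 u = y.1) :
    cls G (squareComm G x y).1 = cls G (degen G 1 1 x.1) *
      (cls G u * (cls G (degen G 1 1 x.1))⁻¹ * (cls G u)⁻¹) := by
  rw [cls_squareComm, cls_conj_eq G (degen G 1 1 x.1) (lift G y.1) u
    (face_zero_degen_one G x x.2) (face_one_lift G y) hu ((face_two_lift G y y.2).trans h.symm)]

theorem cls_conj_moore (a b k : level G 2) (hk : k ∈ moore G 2) (h : face G 1 2 a = face G 1 2 b) :
    cls G a * cls G k * (cls G a)⁻¹ = cls G b * cls G k * (cls G b)⁻¹ := by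
  have hc : Commute (cls G (b⁻¹ * a)) (cls G k) := commute_two_moore G (b⁻¹ * a) k
    (by rw [map_mul, map_inv, h]; simp) hk
  have hc' := hc.eq
  rw [map_mul, map_inv] at hc'
  calc _ = cls G b * ((cls G b)⁻¹ * cls G a * cls G k) * (cls G a)⁻¹ := by group
    _ = _ := by rw [hc']; group

theorem square_peiffer (l l' : topQuot G) :
    squareAct G (squareLam G l).1 l' = l * l' * l⁻¹ := by
  obtain ⟨l, rfl⟩ := QuotientGroup.mk_surjective l
  obtain ⟨l', rfl⟩ := QuotientGroup.mk_surjective l'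
  refine topQuot_ext G ?_
  have h := cls_conj_moore G (degen G 1 1 (face G 1 2 l.1)) l.1 l'.1 l'.2
    (face_two_degen_one G _)
  change cls G (conjHom G (face G 1 2 l.1) l').1 = _
  rw [coe_conj, map_mul, map_mul, map_inv, h, Subgroup.coe_mul, Subgroup.coe_mul,
    Subgroup.coe_inv, map_mul, map_mul, map_inv]

theorem squareLam_act (p : level G 1) (l : topQuot G) :
    (squareLam G (squareAct G p l)).1 = p * (squareLam G l).1 * p⁻¹ := by
  obtain ⟨l, rfl⟩ := QuotientGroup.mk_surjective l
  change face G 1 2 (conjHom G p l).1 = p * face G 1 2 l.1 * p⁻¹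
  rw [coe_conj, map_mul, map_mul, map_inv, face_two_degen_one]

theorem squareLam_h (m : (face G 0 0).ker) (n : (face G 0 1).ker) :
    (squareLam G (squareH G m n)).1 = m.1 * n.1 * m.1⁻¹ * n.1⁻¹ := by
  change face G 1 2 (squareComm G m n).1 = _
  simp only [squareComm, map_mul, map_inv, face_two_degen_one, face_two_lift G n.1 n.2]

theorem squareH_lam (l : topQuot G) (n : (face G 0 1).ker) :
    squareH G (squareLam G l) n = l * squareAct G n.1 l⁻¹ := by
  obtain ⟨l, rfl⟩ := QuotientGroup.mk_surjective l
  refine topQuot_ext G ?_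
  have h1 := cls_conj_moore G (lift G n.1) (degen G 1 1 n.1) (l⁻¹).1 (l⁻¹).2
    ((face_two_lift G n.1 n.2).trans (face_two_degen_one G _).symm)
  have h0 : face G 1 0 (degen G 1 1 (face G 1 2 l.1)) = 1 :=
    face_zero_degen_one G _ (faceToKerZero G l).2
  have h2 := commute_one_zerotwo G (lift G n.1) (l.1⁻¹ * degen G 1 1 (face G 1 2 l.1))
    (face_one_lift G _)
    (by
      rw [map_mul, map_inv, ((mem_moore_two G l).1 l.2).1, h0]
      simp)
    (by rw [map_mul, map_inv, face_two_degen_one]; simp)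
  have h3 : cls G (lift G n.1) * ((cls G l.1)⁻¹ * cls G (degen G 1 1 (face G 1 2 l.1))) =
      (cls G l.1)⁻¹ * cls G (degen G 1 1 (face G 1 2 l.1)) * cls G (lift G n.1) := by
    rw [← map_inv, ← map_mul]
    exact h2.eq
  rw [Subgroup.coe_mul, map_mul, coe_conj, map_mul, map_mul, map_inv (cls G), ← h1,
    cls_squareComm]
  change cls G (degen G 1 1 (face G 1 2 l.1)) * (_ * (cls G (degen G 1 1 (face G 1 2 l.1)))⁻¹ * _)
    = _
  rw [Subgroup.coe_inv, map_inv]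
  generalize cls G (degen G 1 1 (face G 1 2 l.1)) = s at *
  generalize cls G l.1 = a at *
  generalize cls G (lift G n.1) = u at *
  calc _ = a * (a⁻¹ * s * u) * s⁻¹ * u⁻¹ := by group
    _ = _ := by rw [← h3]; group

theorem squareH_lam' (m : (face G 0 0).ker) (l : topQuot G) :
    squareH G m (squareLam' G l) = squareAct G m.1 l * l⁻¹ := by
  obtain ⟨l, rfl⟩ := QuotientGroup.mk_surjective l
  refine topQuot_ext G ?_
  rw [cls_squareComm_eq G m _ l.1 ((mem_moore_two G l).1 l.2).2 rfl]
  simp only [coe_conj, map_mul, map_inv, Subgroup.coe_mul, Subgroup.coe_inv,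
    mul_assoc]

theorem squareH_mul_left (m m' : (face G 0 0).ker) (n : (face G 0 1).ker) :
    squareH G (m * m') n = squareAct G m.1 (squareH G m' n) * squareH G m n := by
  refine topQuot_ext G ?_
  simp only [coe_conj, map_mul, map_inv, Subgroup.coe_mul, cls_squareComm,
    mul_inv_rev, mul_assoc, inv_mul_cancel_left]

theorem squareH_mul_right (m : (face G 0 0).ker) (n n' : (face G 0 1).ker) :
    squareH G m (n * n') = squareH G m n * squareAct G n.1 (squareH G m n') := by
  refine topQuot_ext G ?_
  have h1 := cls_conj_moore G (degen G 1 1 n.1) (lift G n.1) (squareComm G m n').1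
    (squareComm G m n').2 ((face_two_degen_one G _).trans (face_two_lift G n.1 n.2).symm)
  rw [cls_squareComm_eq G m (n * n') (lift G n.1 * lift G n'.1)
    (by rw [map_mul, face_one_lift, face_one_lift, one_mul])
    (by rw [map_mul, face_two_lift G n.1 n.2, face_two_lift G n'.1 n'.2]; rfl),
    Subgroup.coe_mul, coe_conj, map_mul, map_mul, map_mul, map_mul,
    map_inv (cls G), h1]
  simp only [cls_squareComm, mul_inv_rev, mul_assoc, inv_mul_cancel_left]

theorem squareH_act (p : level G 1) (m : (face G 0 0).ker) (n : (face G 0 1).ker) :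
    squareH G (MulAut.conjNormal p m) (MulAut.conjNormal p n) = squareAct G p (squareH G m n) := by
  refine topQuot_ext G ?_
  rw [cls_squareComm_eq G _ _ (degen G 1 1 p * lift G n.1 * (degen G 1 1 p)⁻¹)
    (by rw [map_mul, map_mul, map_inv, face_one_lift]; simp)
    (by rw [map_mul, map_mul, map_inv, face_two_lift G n.1 n.2, face_two_degen_one]
        exact (MulAut.conjNormal_apply _ _).symm)]
  simp only [coe_conj, MulAut.conjNormal_apply, map_mul, map_inv, cls_squareComm, mul_inv_rev,
    mul_assoc, inv_inv, inv_mul_cancel_left]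

theorem squareLam'_coe (l : topQuot G) : (squareLam' G l).1 = (squareLam G l).1 := by
  obtain ⟨l, rfl⟩ := QuotientGroup.mk_surjective l
  rfl

/-- The crossed square `𝔐(G, 2)`:
```
NG₂ / ∂₃ NG₃ ---> Ker d₀
     |               |
     v               v
   Ker d₁ ---------> G₁
```
The maps out of the top left corner are induced by `d₂`, the other two are inclusions; `G₁` acts
by conjugation (via `s₁` on the top left corner). -/
def squareOf : CrossedSquare.{u} where
  L := topQuot G
  M := (face G 0 0).ker
  N := (face G 0 1).ker
  P := level G 1
  lam := squareLam G
  lam' := squareLam' G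
  mu := (face G 0 0).ker.subtype
  nu := (face G 0 1).ker.subtype
  actL := squareAct G
  actM := MulAut.conjNormal
  actN := MulAut.conjNormal
  h := squareH G
  comm l := (squareLam'_coe G l).symm
  crossed_lam := ⟨fun p l => Subtype.ext (squareLam_act G p.1 l), square_peiffer G⟩
  crossed_lam' := ⟨fun p l => Subtype.ext (by
      rw [squareLam'_coe]
      exact (squareLam_act G p.1 l).trans (by rw [← squareLam'_coe]; rfl)),
    fun l l' => by
      rw [MonoidHom.comp_apply, Subgroup.subtype_apply, squareLam'_coe]
      exact square_peiffer G l l'⟩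
  crossed_mu := ⟨fun _ _ => MulAut.conjNormal_apply _ _,
    fun _ _ => Subtype.ext (MulAut.conjNormal_apply _ _)⟩
  crossed_nu := ⟨fun _ _ => MulAut.conjNormal_apply _ _,
    fun _ _ => Subtype.ext (MulAut.conjNormal_apply _ _)⟩
  crossed_kappa := ⟨squareLam_act G, square_peiffer G⟩
  lam_act p l := Subtype.ext ((squareLam_act G p l).trans (MulAut.conjNormal_apply _ _).symm)
  lam'_act p l := Subtype.ext (by
    rw [MulAut.conjNormal_apply, squareLam'_coe, squareLam'_coe, squareLam_act])
  lam_h m n := Subtype.ext ((squareLam_h G m n).trans (by simp [mul_assoc]))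
  lam'_h m n := Subtype.ext (by
    rw [squareLam'_coe, squareLam_h]
    simp)
  h_lam := squareH_lam G
  h_lam' := squareH_lam' G
  h_mul_left := squareH_mul_left G
  h_mul_right := squareH_mul_right G
  h_act := squareH_act G

end SquareOf

end CrossedSquares

namespace CrossedSquares

open CategoryTheory Opposite
open scoped Simplicial

/-! ### The codiagonal of the binerve of a cat²-group, cell by cell -/

namespace Cat2Group

variable (C : Cat2Group.{u})

/-! The compatibility conditions defining `∇X` say exactly that an `n`-simplex of `∇X` is one
coherent family of squares ("cells") indexed by `i ≤ j ≤ k ≤ l ≤ n`: the component `x_p` sees the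
morphisms `i ≤ j` of `{0, …, p}` and `k ≤ l` of `{p, …, n}`, and where two components see the same
pair they agree. Simplicial operators only reindex cells, and by the composition laws the cells at
`(i, k, k, n)` determine all others (`eq_one_of_cell`).

A simplex lies in `Ker d_q` iff all its cells avoiding the vertex `q` are trivial. In degree `≥ 3`
the pair `i, k` always misses one of `0, 1, 2`, so the Moore complex vanishes there. In degree 2
only the cell `(0, 1, 1, 2)` survives; both its targets are trivial, and in the big group `(L ⋊ N) ⋊
(M ⋊ P)` the elements with both targets trivial form a copy of `L`. In degree 1 the cells `(0, 0, 0,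
1)` and `(0, 1, 1, 1)` survive, subject to source and target conditions that leave one free element
of `M` and one of `N`; in degree 0 a doubly degenerate cell remains, that is, an element of `P`.
Conversely, simplices with prescribed cells come from grids of squares with common targets
(`ofGrid`), where all functoriality is automatic. The last face merely restricts the family of
cells, so the differentials can be read off from the composition laws.

The homology of the mapping complex of `squareOf G` is then elementary: `d₁` identifies `G₁ / Ker d₀
Ker d₁` with `π₀(G)`; a 1-cycle is a pair `(n⁻¹, n)` with `n ∈ Ker d₀ ∩ Ker d₁`; and a 2-cycle is a
class modulo `∂₃ NG₃` killed by `d₂`. This part is independent of the codiagonal, and the two halves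
are joined by the invariance of homology under isomorphism of complexes. -/

/-- The value of the `p`-th component of an element of `∇X` on a pair of morphisms. -/
def cellAt {n : ℕ} (x : codiagSubgroup C.binerve n) (p : Fin (n + 1)) (a : OrdArrow ⦋p.1⦌)
    (b : OrdArrow ⦋n - p.1⦌) : C.G :=
  (show C.binerveSubgroup ⦋p.1⦌ ⦋n - p.1⦌ from x.1 p).1 a b

/-- The morphism `i ≤ j` of `[p]`. -/
abbrev arrow {p : ℕ} (i j : ℕ) (h : i ≤ j) (hj : j ≤ p) : OrdArrow ⦋p⦌ :=
  ordArrow (n := ⦋p⦌) ⟨i, Nat.lt_succ_of_le (h.trans hj)⟩ ⟨j, Nat.lt_succ_of_le hj⟩ h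

/-- The value of an element of `∇X` on the morphisms `i ≤ j` and `k ≤ l`, where `j ≤ k`. -/
def cell {n : ℕ} (x : codiagSubgroup C.binerve n) (i j k l : ℕ) (hij : i ≤ j) (hjk : j ≤ k)
    (hkl : k ≤ l) (hl : l ≤ n) : C.G :=
  C.cellAt x ⟨j, Nat.lt_succ_of_le (hjk.trans (hkl.trans hl))⟩ (arrow i j hij le_rfl)
    (arrow (k - j) (l - j) (Nat.sub_le_sub_right hkl j) (Nat.sub_le_sub_right hl j))

variable {C} {n : ℕ} (x : codiagSubgroup C.binerve n)

/-- The compatibility between the components `x_j` and `x_p`, evaluated on a pair of morphisms. It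
makes the choice of `x_j` in `cell` harmless: every component that sees a pair of morphisms gives it
the same value. -/
theorem cellAt_arrow (p i j k l : ℕ) (hij : i ≤ j) (hjp : j ≤ p) (hkl : k ≤ l) (hl : p + l ≤ n) :
    C.cellAt x ⟨p, by omega⟩ (arrow i j hij hjp) (arrow k l hkl (by omega : l ≤ n - p)) =
      C.cell x i j (p + k) (p + l) hij (by omega) (by omega) hl := by
  have h := codiag_compat C.binerve n x j p hjp (by omega)
  have h' := congrFun (congrFun (congrArg (fun y : C.binerveSubgroup ⦋j⦌ ⦋n - p⦌ => y.1) h)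
    (arrow i j hij le_rfl)) (arrow k l hkl (by omega : l ≤ n - p))
  refine Eq.trans h'.symm ?_
  change C.cellAt x ⟨j, _⟩ (arrow i j hij le_rfl)
    (arrow (k + (p - j)) (l + (p - j)) (by omega) (by omega : l + (p - j) ≤ n - j)) = _
  unfold cell
  congr 2 <;> omega

theorem cell_ext {x y : codiagSubgroup C.binerve n}
    (h : ∀ i j k l hij hjk hkl hl, C.cell x i j k l hij hjk hkl hl =
      C.cell y i j k l hij hjk hkl hl) : x = y := by
  refine Subtype.ext (funext fun p => ?_)
  refine Subtype.ext (a1 := (show C.binerveSubgroup ⦋p.1⦌ ⦋n - p.1⦌ from x.1 p))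
    (a2 := (show C.binerveSubgroup ⦋p.1⦌ ⦋n - p.1⦌ from y.1 p)) (funext fun a => funext fun b => ?_)
  obtain ⟨⟨⟨i, hi⟩, ⟨j, hj⟩⟩, hij⟩ := a
  obtain ⟨⟨⟨k, hk⟩, ⟨l, hl⟩⟩, hkl⟩ := b
  obtain ⟨p, hp⟩ := p
  change i < p + 1 at hi
  change j < p + 1 at hj
  change k < n - p + 1 at hk
  change l < n - p + 1 at hl
  change i ≤ j at hij
  change k ≤ l at hkl
  have hx := cellAt_arrow x p i j k l hij (by omega) hkl (by omega)
  have hy := cellAt_arrow y p i j k l hij (by omega) hkl (by omega)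
  exact hx.trans ((h _ _ _ _ _ _ _ _).trans hy.symm)

@[simp]
theorem cell_one (i j k l : ℕ) (hij : i ≤ j) (hjk : j ≤ k) (hkl : k ≤ l) (hl : l ≤ n) :
    C.cell (1 : codiagSubgroup C.binerve n) i j k l hij hjk hkl hl = 1 := rfl

section Laws

variable (i j k l m : ℕ)

theorem s₂_cell (hij : i ≤ j) (hjk : j ≤ k) (hkl : k ≤ l) (hl : l ≤ n) :
    C.s₂ (C.cell x i j k l hij hjk hkl hl) = C.cell x i j k k hij hjk le_rfl (by omega) :=
  ((show C.binerveSubgroup ⦋j⦌ ⦋n - j⦌ from x.1 ⟨j, by omega⟩).2.2 _).source _ _ _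

theorem t₂_cell (hij : i ≤ j) (hjk : j ≤ k) (hkl : k ≤ l) (hl : l ≤ n) :
    C.t₂ (C.cell x i j k l hij hjk hkl hl) = C.cell x i j l l hij (by omega) le_rfl (by omega) :=
  ((show C.binerveSubgroup ⦋j⦌ ⦋n - j⦌ from x.1 ⟨j, by omega⟩).2.2 _).target _ _ _

theorem cell_comp₂ (hij : i ≤ j) (hjk : j ≤ k) (hkl : k ≤ l) (hlm : l ≤ m) (hm : m ≤ n) :
    C.cell x i j k m hij hjk (hkl.trans hlm) hm =
      C.cell x i j l m hij (hjk.trans hkl) hlm hm *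
        (C.cell x i j l l hij (hjk.trans hkl) le_rfl (hlm.trans hm))⁻¹ *
        C.cell x i j k l hij hjk hkl (hlm.trans hm) :=
  ((show C.binerveSubgroup ⦋j⦌ ⦋n - j⦌ from x.1 ⟨j, by omega⟩).2.2 _).comp _ _ _
    (Nat.sub_le_sub_right hkl j) (Nat.sub_le_sub_right hlm j)

/-- The form of `cellAt_arrow` in absolute vertex numbers. The first-direction laws below need it
because they compare cells with different second vertices, which `cell` reads from different
components. -/
theorem cellAt_arrow_sub (p : ℕ) (hij : i ≤ j) (hjp : j ≤ p) (hpk : p ≤ k) (hkl : k ≤ l)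
    (hl : l ≤ n) :
    C.cellAt x ⟨p, by omega⟩ (arrow i j hij hjp)
      (arrow (k - p) (l - p) (Nat.sub_le_sub_right hkl p) (Nat.sub_le_sub_right hl p)) =
      C.cell x i j k l hij (by omega) (by omega) hl := by
  rw [cellAt_arrow x p i j (k - p) (l - p) hij hjp _ (by omega)]
  congr 1 <;> omega

theorem s₁_cell (hij : i ≤ j) (hjk : j ≤ k) (hkl : k ≤ l) (hl : l ≤ n) :
    C.s₁ (C.cell x i j k l hij hjk hkl hl) = C.cell x i i k l le_rfl (by omega) hkl hl := by
  rw [← cellAt_arrow_sub x i i k l j le_rfl hij hjk hkl hl]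
  exact ((show C.binerveSubgroup ⦋j⦌ ⦋n - j⦌ from x.1 ⟨j, by omega⟩).2.1 _).source _ _ _

theorem t₁_cell (hij : i ≤ j) (hjk : j ≤ k) (hkl : k ≤ l) (hl : l ≤ n) :
    C.t₁ (C.cell x i j k l hij hjk hkl hl) = C.cell x j j k l le_rfl (by omega) hkl hl :=
  ((show C.binerveSubgroup ⦋j⦌ ⦋n - j⦌ from x.1 ⟨j, by omega⟩).2.1 _).target _ _ _

theorem cell_comp₁ (hij : i ≤ j) (hjk : j ≤ k) (hkl : k ≤ l) (hlm : l ≤ m) (hm : m ≤ n) :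
    C.cell x i k l m (hij.trans hjk) hkl hlm hm =
      C.cell x j k l m hjk hkl hlm hm *
        (C.cell x j j l m le_rfl (hjk.trans hkl) hlm hm)⁻¹ *
        C.cell x i j l m hij (hjk.trans hkl) hlm hm := by
  rw [← cellAt_arrow_sub x i j l m k hij hjk hkl hlm hm,
    ← cellAt_arrow_sub x j j l m k le_rfl hjk hkl hlm hm]
  exact ((show C.binerveSubgroup ⦋k⦌ ⦋n - k⦌ from x.1 ⟨k, by omega⟩).2.1 _).comp
    ⟨i, _⟩ ⟨j, _⟩ ⟨k, _⟩ hij hjk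

end Laws

/-- An element of `∇X` is determined by its cells of the form `i ≤ k ≤ k ≤ n`. -/
theorem eq_one_of_cell (h : ∀ i k hik hk, C.cell x i k k n hik le_rfl hk le_rfl = 1) : x = 1 := by
  -- Cut the cell at `(i, k, k, n)` along `j` in the first direction; the middle factor is a source
  -- of a trivial cell. The same argument in the second direction, cutting at `l`, then reaches an
  -- arbitrary cell.
  have h1 : ∀ i j k hij hjk hk, C.cell x i j k n hij hjk hk le_rfl = 1 := by
    intro i j k hij hjk hk
    have e := cell_comp₁ x i j k k n hij hjk le_rfl hk le_rfl
    rw [h, h, ← s₁_cell x j k k n hjk le_rfl hk le_rfl, h] at e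
    simpa using e.symm
  refine cell_ext fun i j k l hij hjk hkl hl => ?_
  have e := cell_comp₂ x i j k l n hij hjk hkl hl le_rfl
  rw [h1, h1, ← s₂_cell x i j l n hij _ hl le_rfl, h1] at e
  simpa using e.symm

theorem cell_codiagMap {m : ℕ} (θ : ⦋m⦌ ⟶ ⦋n⦌) (i j k l : Fin (m + 1)) (hij : i ≤ j)
    (hjk : j ≤ k) (hkl : k ≤ l) :
    C.cell (codiagMap C.binerve θ x) i j k l hij hjk hkl (Nat.le_of_lt_succ l.2) =
      C.cell x (θ.toOrderHom i) (θ.toOrderHom j) (θ.toOrderHom k) (θ.toOrderHom l)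
        (θ.toOrderHom.monotone hij) (θ.toOrderHom.monotone hjk) (θ.toOrderHom.monotone hkl)
        (Nat.le_of_lt_succ (θ.toOrderHom l).2) := by
  -- The second pair of vertices is stored relative to `j`, so `upperPart` evaluates `θ` at `j + (k
  -- - j)` and `j + (l - j)`.
  have hk : (⟨j.1 + (k.1 - j.1), by omega⟩ : Fin (m + 1)) = k := Fin.ext (by simp; omega)
  have hl : (⟨j.1 + (l.1 - j.1), by omega⟩ : Fin (m + 1)) = l := Fin.ext (by simp; omega)
  have hm : (⟨j.1 + (k.1 - j.1), by omega⟩ : Fin (m + 1)) ≤ ⟨j.1 + (l.1 - j.1), by omega⟩ := by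
    rwa [hk, hl]
  change C.cellAt x (θ.toOrderHom j)
    (arrow (θ.toOrderHom i).1 (θ.toOrderHom j).1 (θ.toOrderHom.monotone hij) le_rfl)
    (arrow ((θ.toOrderHom ⟨j.1 + (k.1 - j.1), _⟩).1 - (θ.toOrderHom j).1)
      ((θ.toOrderHom ⟨j.1 + (l.1 - j.1), _⟩).1 - (θ.toOrderHom j).1)
      (Nat.sub_le_sub_right (θ.toOrderHom.monotone hm) _)
      (Nat.sub_le_sub_right (Nat.le_of_lt_succ (θ.toOrderHom _).2) _)) = _
  simp only [hk, hl]
  rfl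

end Cat2Group

end CrossedSquares

namespace CrossedSquares

open CategoryTheory Opposite
open scoped Simplicial

/-! ### Constructing simplices of the codiagonal from grids of squares. -/

theorem IsFunctorial.hom {G : Type u} [Group G] {s t : G →* G} {n : SimplexCategory} (φ : G →* G)
    (hs : ∀ x, s (φ x) = φ (s x)) (ht : ∀ x, t (φ x) = φ (t x)) {x : OrdArrow n → G}
    (hx : IsFunctorial s t x) : IsFunctorial s t (fun a => φ (x a)) where
  source i j h := by rw [hs, hx.source]
  target i j h := by rw [ht, hx.target]
  comp i j k h h' := by rw [hx.comp i j k h h', map_mul, map_mul, map_inv]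

/-- A family of morphisms with a common target gives a functor: the value on `i ≤ j` is `f i`
followed by the inverse of `f j`. -/
theorem IsFunctorial.ofCone {G : Type u} [Group G] {s t : G →* G} (hG : IsCat1 s t)
    {n : SimplexCategory} (f : Fin (n.len + 1) → G) (hf : ∀ i j, t (f i) = t (f j)) :
    IsFunctorial s t (fun a : OrdArrow n => s (f a.1.2) * (f a.1.2)⁻¹ * f a.1.1) where
  source i j h := by
    have ss : ∀ x, s (s x) = s x := fun x => by rw [← hG.t_s x, hG.s_t]
    simp only [map_mul, map_inv, ss]
    simp
  target i j h := by
    simp only [map_mul, map_inv, hG.t_s, hf i j]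
    simp
  comp i j k h h' := by simp [mul_assoc]

namespace Cat2Group

variable (C : Cat2Group.{u})

/-- The edge in the second direction of a grid of squares with common targets. -/
def gridEdge (F : ℕ → ℕ → C.G) (i k l : ℕ) : C.G := C.s₂ (F i l) * (F i l)⁻¹ * F i k

/-- The square on `i ≤ j` and `k ≤ l` of a grid of squares with common targets. -/
def gridSquare (F : ℕ → ℕ → C.G) (i j k l : ℕ) : C.G :=
  C.s₁ (C.gridEdge F j k l) * (C.gridEdge F j k l)⁻¹ * C.gridEdge F i k l

/-- This and the next two lemmas evaluate grid squares when the factors comparing with the far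
vertices cancel; they cover every cell needed for surjectivity. -/
theorem gridSquare_left (F : ℕ → ℕ → C.G) (i k l : ℕ) (h : C.s₂ (F i l) = F i l) :
    C.gridSquare F i i k l = C.s₁ (F i k) := by
  simp [gridSquare, gridEdge, h]

theorem gridSquare_bot (F : ℕ → ℕ → C.G) (i j k l : ℕ) (hjk : F j k = 1) (hjl : F j l = 1)
    (h : C.s₂ (F i l) = F i l) : C.gridSquare F i j k l = F i k := by
  simp [gridSquare, gridEdge, hjk, hjl, h]

theorem gridSquare_corner (F : ℕ → ℕ → C.G) (i j k l : ℕ) (hjk : F j k = 1) (hjl : F j l = 1)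
    (hil : F i l = 1) : C.gridSquare F i j k l = F i k :=
  C.gridSquare_bot F i j k l hjk hjl (by rw [hil, map_one])

/-- The element of `∇X` given by a grid of squares with common targets. -/
def ofGrid (F : ℕ → ℕ → C.G) (h₁ : ∀ i i' k, C.t₁ (F i k) = C.t₁ (F i' k))
    (h₂ : ∀ i k k', C.t₂ (F i k) = C.t₂ (F i k')) (n : ℕ) : codiagSubgroup C.binerve n where
  val p :=
    { val := fun a b => C.gridSquare F a.1.1 a.1.2 (p + b.1.1) (p + b.1.2)
      property := by
        refine ⟨fun b => ?_, fun a => ?_⟩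
        · refine IsFunctorial.ofCone (n := ⦋p.1⦌) C.isCat1₁
            (fun i : Fin (p.1 + 1) => C.gridEdge F i (p + b.1.1) (p + b.1.2)) fun i j => ?_
          -- Since `t₁` commutes with `s₂`, the first target of an edge is a word in the first
          -- targets of the grid entries, hence independent of the row.
          simp only [gridEdge, map_mul, map_inv, C.t_s]
          rw [h₁ i j, h₁ i j]
        · have e : ∀ i, IsFunctorial (n := ⦋n - p.1⦌) C.s₂ C.t₂
              (fun b => C.gridEdge F i (p + b.1.1) (p + b.1.2)) := fun i =>
            IsFunctorial.ofCone C.isCat1₂ (fun k : Fin (n - p.1 + 1) => F i (p + k))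
              fun k l => h₂ _ _ _
          -- The square is a product of edges, an inverse edge and the `s₁`-image of an edge, and
          -- functorial families are closed under these operations.
          exact (((e a.1.2).hom C.s₁ (fun x => (C.s_s x).symm) (fun x => (C.s_t x).symm)).mul
            C.isCat1₂ ((e a.1.2).inv C.isCat1₂)).mul C.isCat1₂ (e a.1.1) }
  property p hp := by
    refine Subtype.ext (a1 := (show C.binerveSubgroup ⦋p⦌ ⦋n - (p + 1)⦌ from _))
      (a2 := (show C.binerveSubgroup ⦋p⦌ ⦋n - (p + 1)⦌ from _))
      (funext fun a => funext fun b => ?_)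
    -- The grid is indexed by absolute vertex numbers, so the compatibility condition is mere
    -- arithmetic of indices.
    change C.gridSquare F a.1.1 a.1.2 (p + (b.1.1.1 + (p + 1 - p))) (p + (b.1.2.1 + (p + 1 - p))) =
      C.gridSquare F a.1.1 a.1.2 (p + 1 + b.1.1.1) (p + 1 + b.1.2.1)
    congr 1 <;> omega

theorem cell_ofGrid (F : ℕ → ℕ → C.G) (h₁ : ∀ i i' k, C.t₁ (F i k) = C.t₁ (F i' k))
    (h₂ : ∀ i k k', C.t₂ (F i k) = C.t₂ (F i k')) (n i j k l : ℕ) (hij : i ≤ j)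
    (hjk : j ≤ k) (hkl : k ≤ l) (hl : l ≤ n) :
    C.cell (C.ofGrid F h₁ h₂ n) i j k l hij hjk hkl hl = C.gridSquare F i j k l := by
  change C.gridSquare F i j (j + (k - j)) (j + (l - j)) = _
  congr 1 <;> omega

variable {C} {n : ℕ}

/-! ### Faces and the Moore complex in terms of cells. -/

theorem cell_face (x : codiagSubgroup C.binerve (n + 1)) (q : Fin (n + 2)) (i j k l : Fin (n + 1))
    (hij : i ≤ j) (hjk : j ≤ k) (hkl : k ≤ l) :
    C.cell (face (codiagonal C.binerve) n q x : codiagSubgroup C.binerve n) i j k l hij hjk hkl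
        (Nat.le_of_lt_succ l.2) =
      C.cell x (q.succAbove i) (q.succAbove j) (q.succAbove k) (q.succAbove l)
        ((Fin.strictMono_succAbove q).monotone hij) ((Fin.strictMono_succAbove q).monotone hjk)
        ((Fin.strictMono_succAbove q).monotone hkl) (Nat.le_of_lt_succ (q.succAbove l).2) :=
  cell_codiagMap x (SimplexCategory.δ q) i j k l hij hjk hkl

/-- Omitting the last vertex renumbers nothing; this is why the Moore differential is a restriction
of cells. -/
theorem cell_face_last (x : codiagSubgroup C.binerve (n + 1)) (i j k l : ℕ)
    (hij : i ≤ j) (hjk : j ≤ k) (hkl : k ≤ l) (hl : l ≤ n) :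
    C.cell (face (codiagonal C.binerve) n (Fin.last (n + 1)) x : codiagSubgroup C.binerve n)
      i j k l hij hjk hkl hl = C.cell x i j k l hij hjk hkl (by omega) := by
  have h := cell_face x (Fin.last (n + 1)) ⟨i, by omega⟩ ⟨j, by omega⟩ ⟨k, by omega⟩ ⟨l, by omega⟩
    hij hjk hkl
  simpa only [Fin.succAbove_last, Fin.val_castSucc] using h

/-- A cell none of whose vertices is `q` is a cell of `d_q x`, and `d_q x = 1` for `q ≤ n`. -/
theorem cell_eq_one_of_mem_moore (x : codiagSubgroup C.binerve (n + 1))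
    (hx : x ∈ moore (codiagonal C.binerve) (n + 1)) (q : ℕ) (hq : q ≤ n) (i j k l : ℕ)
    (hij : i ≤ j) (hjk : j ≤ k) (hkl : k ≤ l) (hl : l ≤ n + 1) (hi : i ≠ q) (hj : j ≠ q)
    (hk : k ≠ q) (hl' : l ≠ q) : C.cell x i j k l hij hjk hkl hl = 1 := by
  have hq' : q < n + 2 := by omega
  have h := (mem_moore_succ (codiagonal C.binerve) n x).1 hx ⟨q, by omega⟩
  have ex (a : ℕ) (ha : a ≤ n + 1) (haq : a ≠ q) :
      ∃ b : Fin (n + 1), (Fin.succAbove (⟨q, hq'⟩ : Fin (n + 2)) b).1 = a := by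
    obtain ⟨b, hb⟩ := Fin.exists_succAbove_eq (x := (⟨a, by omega⟩ : Fin (n + 2)))
      (y := ⟨q, hq'⟩) (fun e => haq (congrArg Fin.val e))
    exact ⟨b, congrArg Fin.val hb⟩
  obtain ⟨i, rfl⟩ := ex i (by omega) hi
  obtain ⟨j, rfl⟩ := ex j (by omega) hj
  obtain ⟨k, rfl⟩ := ex k (by omega) hk
  obtain ⟨l, rfl⟩ := ex l (by omega) hl'
  refine (cell_face x ⟨q, hq'⟩ i j k l ?_ ?_ ?_).symm.trans ?_
  · exact (Fin.strictMono_succAbove _).le_iff_le.1 hij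
  · exact (Fin.strictMono_succAbove _).le_iff_le.1 hjk
  · exact (Fin.strictMono_succAbove _).le_iff_le.1 hkl
  · have h' : (face (codiagonal C.binerve) n ⟨q, hq'⟩ x : codiagSubgroup C.binerve n) = 1 := h
    rw [h']
    rfl

/-- Converse criterion, which by `eq_one_of_cell` only has to test the cells ending in `k, k, n +
1`. -/
theorem mem_moore_of_cell (x : codiagSubgroup C.binerve (n + 1))
    (h : ∀ q i k (_ : q ≤ n) (hik : i ≤ k) (hk : k ≤ n + 1), i ≠ q → k ≠ q →
      C.cell x i k k (n + 1) hik le_rfl hk le_rfl = 1) :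
    x ∈ moore (codiagonal C.binerve) (n + 1) := by
  refine (mem_moore_succ (codiagonal C.binerve) n x).2 fun q => ?_
  refine eq_one_of_cell (C := C) (n := n) _ fun i k hik hk => ?_
  refine (cell_face x q.castSucc ⟨i, by omega⟩ ⟨k, by omega⟩ ⟨k, by omega⟩ (Fin.last n)
    hik le_rfl hk).trans ?_
  -- As `q` is not the last vertex, `δ_q` sends the last vertex `n` to `n + 1`, so the determining
  -- cells of `d_q x` are again of the form `(i, k, k, n + 1)`.
  have e : (q.castSucc.succAbove (Fin.last n)).1 = n + 1 := by
    rw [Fin.succAbove_of_le_castSucc _ _ (Fin.castSucc_le_castSucc_iff.2 (Fin.le_last q))]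
    simp
  have := h q (q.castSucc.succAbove ⟨i, by omega⟩) (q.castSucc.succAbove ⟨k, by omega⟩)
    (by omega) ((Fin.strictMono_succAbove _).monotone hik) (by omega)
    (fun e => Fin.succAbove_ne q.castSucc _ (Fin.ext e))
    (fun e => Fin.succAbove_ne q.castSucc _ (Fin.ext e))
  simp only [e]
  exact this

theorem eq_one_of_mem_moore (x : codiagSubgroup C.binerve (n + 3))
    (hx : x ∈ moore (codiagonal C.binerve) (n + 3)) : x = 1 := by
  refine eq_one_of_cell x fun i k hik hk => ?_
  -- Two vertices cannot exhaust `{0, 1, 2}`, and the final vertex `n + 3` is not among these; this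
  -- is where degree at least three enters.
  obtain ⟨q, hq, hi, hk'⟩ : ∃ q ≤ 2, i ≠ q ∧ k ≠ q := by
    by_contra! h
    have h0 := h 0 (by omega)
    have h1 := h 1 (by omega)
    have h2 := h 2 (by omega)
    omega
  exact cell_eq_one_of_mem_moore x hx q (by omega) i k k (n + 3) hik le_rfl hk le_rfl hi hk' hk'
    (by omega)

end Cat2Group

end CrossedSquares

namespace CrossedSquares

open CategoryTheory Opposite

namespace CrossedSquare

variable (S : CrossedSquare.{u})

/-! ### Elements of the cat²-group of a crossed square with trivial targets -/

variable {S}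

theorem right_eq_of_t₁ {z : S.Big} (h : S.t₁ z = 1) : z.right = (S.bdry z.left)⁻¹ :=
  (inv_eq_of_mul_eq_one_right (congrArg SemidirectProduct.right h)).symm

theorem left_right_eq_of_t₂ {z : S.Big} (h : S.t₂ z = 1) : z.left.right = (S.lam' z.left.left)⁻¹ :=
  (inv_eq_of_mul_eq_one_right (congrArg (fun y : S.Big => y.left.right) h)).symm

/-- When `t₁ z = 1`, `z.right` is the boundary of `z.left⁻¹`, so by the Peiffer identity it acts as
conjugation by `z.left⁻¹`. The order of multiplication is therefore reversed, which explains the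
inverses in `bigN` and `toMN`. -/
theorem left_mul_of_t₁ {z w : S.Big} (h : S.t₁ z = 1) : (z * w).left = w.left * z.left := by
  rw [SemidirectProduct.mul_left, right_eq_of_t₁ h, ← map_inv, S.crossed_bdry.peiffer]
  group

/-- A second reversal, from the Peiffer identity of `L → N`, undoes that of `left_mul_of_t₁`; hence
the `L`-coordinate is multiplicative without an inverse. -/
theorem left_left_mul_of_t {z w : S.Big} (hz : S.t₁ z = 1) (hw : S.t₂ w = 1) :
    (z * w).left.left = z.left.left * w.left.left := by
  have h := S.crossed_lam'.peiffer w.left.left⁻¹ z.left.left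
  rw [left_mul_of_t₁ hz, SemidirectProduct.mul_left, left_right_eq_of_t₂ hw, ← map_inv, h]
  group

/-- The twist in the inverse is by `ν λ' l = μ λ l`, which acts on `M` as conjugation by `λ l` and
so fixes `(λ l)⁻¹`. This is the source of the inverse in `∂₂ l = (λ(l)⁻¹, λ'(l))`. -/
theorem right_left_of_t {z : S.Big} (h₁ : S.t₁ z = 1) (h₂ : S.t₂ z = 1) :
    z.right.left = (S.lam z.left.left)⁻¹ := by
  rw [right_eq_of_t₁ h₁, SemidirectProduct.inv_left]
  change S.actM (S.nu z.left.right)⁻¹ (S.lam z.left.left)⁻¹ = _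
  have h := S.crossed_mu.peiffer (S.lam z.left.left) (S.lam z.left.left)⁻¹
  rw [S.comm] at h
  rw [left_right_eq_of_t₂ h₂, map_inv S.nu, inv_inv, h, mul_inv_cancel, one_mul]

variable (S)

/-- The element of `Ker t₁ ∩ Ker t₂` given by an element of `L`. -/
def bigL (l : S.L) : S.Big :=
  ⟨⟨l, (S.lam' l)⁻¹⟩, (S.bdry ⟨l, (S.lam' l)⁻¹⟩)⁻¹⟩

theorem t₁_bigL (l : S.L) : S.t₁ (S.bigL l) = 1 :=
  SemidirectProduct.ext rfl (mul_inv_cancel _)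

theorem t₂_bigL (l : S.L) : S.t₂ (S.bigL l) = 1 := by
  have h : (S.bigL l).right = ⟨(S.lam l)⁻¹, S.mu (S.lam l)⟩ := by
    have hp := S.crossed_mu.peiffer (S.lam l) (S.lam l)⁻¹
    rw [S.comm] at hp
    ext
    · simp only [bigL, bdry, MonoidHom.coe_mk, OneHom.coe_mk, SemidirectProduct.inv_left, map_inv,
        inv_inv]
      rw [← map_inv, hp]
      group
    · simp [bigL, bdry, S.comm]
  ext
  · rfl
  · exact mul_inv_cancel _
  · rfl
  · simp [t₂, h]

/-- The element of `Ker t₁` given by an element of `N`. -/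
def bigN (n : S.N) : S.Big := ⟨⟨1, n⁻¹⟩, ⟨1, S.nu n⟩⟩

theorem s₂_bigN (n : S.N) : S.s₂ (S.bigN n) = S.bigN n := rfl

theorem t₁_bigN (n : S.N) : S.t₁ (S.bigN n) = 1 := by
  ext <;> simp [t₁, bigN, bdry]

/-- The element of `Ker t₂` given by an element of `M`. -/
def bigM (m : S.M) : S.Big := ⟨1, ⟨m⁻¹, S.mu m⟩⟩

theorem t₂_bigM (m : S.M) : S.t₂ (S.bigM m) = 1 := by
  ext <;> simp [t₂, bigM]

/-! ### The Moore complex of the codiagonal of the binerve -/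

/-- The simplicial group `∇X`, for the bisimplicial nerve `X` of a crossed square. -/
abbrev nabla : SimplicialGroup.{u} := codiagonal S.toCat2Group.binerve

variable {S}

/-- A cell of an element of the Moore complex of `∇X`. -/
abbrev mcell {n : ℕ} (x : moore S.nabla n) (i j k l : ℕ) (hij : i ≤ j := by decide)
    (hjk : j ≤ k := by decide) (hkl : k ≤ l := by decide) (hl : l ≤ n := by decide) : S.Big :=
  S.toCat2Group.cell (n := n) x.1 i j k l hij hjk hkl hl

/-! ### Degree one: the two surviving cells and `M ⋊ N`. -/

section DegreeOne

variable (x : moore S.nabla 1)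

theorem t₁_mcell_0111 : S.t₁ (mcell x 0 1 1 1) = 1 :=
  (Cat2Group.t₁_cell (C := S.toCat2Group) _ _ _ _ _ _ _ _ _).trans
    (Cat2Group.cell_eq_one_of_mem_moore x.1 x.2 0 le_rfl 1 1 1 1 le_rfl le_rfl le_rfl le_rfl
      one_ne_zero one_ne_zero one_ne_zero one_ne_zero)

theorem s₂_mcell_0111 : S.s₂ (mcell x 0 1 1 1) = mcell x 0 1 1 1 :=
  Cat2Group.s₂_cell (C := S.toCat2Group) _ _ _ _ _ _ _ _ _

theorem s₁_mcell_0001 : S.s₁ (mcell x 0 0 0 1) = mcell x 0 0 0 1 :=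
  Cat2Group.s₁_cell (C := S.toCat2Group) _ _ _ _ _ _ _ _ _

/-- Both sides are the degenerate cell at `(0, 0, 1, 1)`. This shared corner is the only relation
between the two surviving cells and fixes the `P`-coordinate in `mcell_0001`. -/
theorem t₂_mcell_0001 : S.t₂ (mcell x 0 0 0 1) = S.s₁ (mcell x 0 1 1 1) :=
  (Cat2Group.t₂_cell (C := S.toCat2Group) _ _ _ _ _ _ _ _ _).trans
    (Cat2Group.s₁_cell (C := S.toCat2Group) _ _ _ _ _ _ _ _ _).symm

/-- The element of `M ⋊ N` given by an element of the Moore complex of degree one. -/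
def toMN : S.MN := ⟨(mcell x 0 0 0 1).right.left⁻¹, (mcell x 0 1 1 1).left.right⁻¹⟩

theorem mcell_0111 : mcell x 0 1 1 1 = S.bigN (toMN x).right := by
  have h₁ := right_eq_of_t₁ (t₁_mcell_0111 x)
  have h₂ := s₂_mcell_0111 x
  have hl : (mcell x 0 1 1 1).left.left = 1 := (congrArg (fun z : S.Big => z.left.left) h₂).symm
  ext
  · exact hl
  · exact (inv_inv _).symm
  · rw [h₁]
    simp [bdry, hl, bigN]
  · rw [h₁]
    simp [bdry, bigN, toMN]

theorem mcell_0001 : mcell x 0 0 0 1 =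
    ⟨1, ⟨(toMN x).left⁻¹, S.mu (toMN x).left * S.nu (toMN x).right⟩⟩ := by
  have h₁ := s₁_mcell_0001 x
  have h₂ := congrArg (fun z : S.Big => z.right.right) (t₂_mcell_0001 x)
  rw [mcell_0111] at h₂
  have hl : (mcell x 0 0 0 1).left = 1 := (congrArg (fun z : S.Big => z.left) h₁).symm
  have h₃ : S.mu (mcell x 0 0 0 1).right.left * (mcell x 0 0 0 1).right.right =
    S.nu (toMN x).right := h₂
  ext : 1
  · exact hl
  · ext
    · exact (inv_inv _).symm
    · change _ = S.mu (toMN x).left * S.nu (toMN x).right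
      rw [← h₃]
      simp [toMN]

variable (S)

/-- The map `N(∇X)₁ → M ⋊ N`. -/
def mooreToMN : moore S.nabla 1 →* S.MN where
  toFun := toMN
  map_one' := by
    ext
    · exact inv_one
    · exact inv_one
  map_mul' x y := by
    have hv : mcell (x * y) 0 0 0 1 = mcell x 0 0 0 1 * mcell y 0 0 0 1 := rfl
    have he : mcell (x * y) 0 1 1 1 = mcell x 0 1 1 1 * mcell y 0 1 1 1 := rfl
    have hp := fun a b => S.crossed_mu.peiffer a b
    ext
    · change (mcell (x * y) 0 0 0 1).right.left⁻¹ = _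
      rw [hv, mcell_0001, mcell_0001]
      -- The `P`-coordinate `μ(m) ν(n)` acts on `M` as `n` followed by conjugation by `m`; after
      -- inversion this is the product of `M ⋊ N`.
      simp [hp, mul_assoc]
    · change (mcell (x * y) 0 1 1 1).left.right⁻¹ = _
      rw [he, left_mul_of_t₁ (t₁_mcell_0111 x)]
      simp [toMN]

theorem mooreToMN_injective : Function.Injective S.mooreToMN := by
  refine (injective_iff_map_eq_one _).2 fun x hx => Subtype.ext ?_
  have hx' : toMN x = 1 := hx
  have he := mcell_0111 x
  have hv := mcell_0001 x
  rw [hx'] at he hv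
  refine Cat2Group.eq_one_of_cell (C := S.toCat2Group) (n := 1) _ fun i k hik hk => ?_
  interval_cases k <;> interval_cases i
  · refine hv.trans (SemidirectProduct.ext rfl (SemidirectProduct.ext inv_one
      (map_one S.mapD₁)))
  · refine he.trans (SemidirectProduct.ext (SemidirectProduct.ext rfl inv_one)
      (SemidirectProduct.ext rfl (map_one S.nu)))
  · exact Cat2Group.cell_eq_one_of_mem_moore x.1 x.2 0 le_rfl 1 1 1 1 le_rfl le_rfl le_rfl le_rfl
      one_ne_zero one_ne_zero one_ne_zero one_ne_zero

theorem mooreToMN_surjective : Function.Surjective S.mooreToMN := by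
  rintro ⟨m, n⟩
  -- The `M`-factor has trivial `t₂` and depends only on `k`; the `N`-factor has trivial `t₁` and
  -- depends only on `i`. So the targets agree as `ofGrid` requires, and the entry at `(1, 1)` is
  -- trivial.
  let F : ℕ → ℕ → S.Big := fun i k =>
    (if k = 0 then S.bigM m else 1) * (if i = 0 then S.bigN n else 1)
  have h₁ : ∀ i i' k, S.t₁ (F i k) = S.t₁ (F i' k) := by
    have h (i : ℕ) : S.t₁ (if i = 0 then S.bigN n else 1) = 1 := by
      split_ifs
      · exact S.t₁_bigN n
      · exact map_one _
    intro i i' k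
    simp only [F, map_mul, h]
  have h₂ : ∀ i k k', S.t₂ (F i k) = S.t₂ (F i k') := by
    have h (k : ℕ) : S.t₂ (if k = 0 then S.bigM m else 1) = 1 := by
      split_ifs
      · exact S.t₂_bigM m
      · exact map_one _
    intro i k k'
    simp only [F, map_mul, h]
  let y : codiagSubgroup S.toCat2Group.binerve 1 := S.toCat2Group.ofGrid F h₁ h₂ 1
  have hF00 : F 0 0 = S.bigM m * S.bigN n := rfl
  have hF01 : F 0 1 = S.bigN n := one_mul _
  have hs₂ : S.s₂ (F 0 1) = F 0 1 := by rw [hF01, s₂_bigN]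
  have hF11 : F 1 1 = 1 := one_mul _
  have hy : y ∈ moore S.nabla 1 := by
    refine Cat2Group.mem_moore_of_cell _ fun q i k hq hik hk hi hk' => ?_
    obtain rfl : q = 0 := by omega
    obtain rfl : i = 1 := by omega
    obtain rfl : k = 1 := by omega
    exact (Cat2Group.cell_ofGrid S.toCat2Group F h₁ h₂ ..).trans
      ((Cat2Group.gridSquare_corner _ _ _ _ _ _ hF11 hF11 hF11).trans hF11)
  refine ⟨⟨y, hy⟩, ?_⟩
  have hv : mcell ⟨y, hy⟩ 0 0 0 1 = S.s₁ (S.bigM m * S.bigN n) := by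
    rw [← hF00]
    exact (Cat2Group.cell_ofGrid S.toCat2Group F h₁ h₂ ..).trans
      (Cat2Group.gridSquare_left _ _ _ _ _ hs₂)
  have he : mcell ⟨y, hy⟩ 0 1 1 1 = S.bigN n :=
    (Cat2Group.cell_ofGrid S.toCat2Group F h₁ h₂ ..).trans
      ((Cat2Group.gridSquare_bot _ _ _ _ _ _ hF11 hF11 hs₂).trans hF01)
  change toMN _ = _
  rw [toMN, hv, he]
  ext
  · simp [s₁, bigM, bigN]
  · simp [bigN]

end DegreeOne

/-! ### Degree zero: doubly degenerate cells and `P`. -/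

section DegreeZero

theorem s_mcell_0000 (x : moore S.nabla 0) : S.s₁ (S.s₂ (mcell x 0 0 0 0)) = mcell x 0 0 0 0 :=
  (congrArg S.s₁ (Cat2Group.s₂_cell (C := S.toCat2Group) _ _ _ _ _ _ _ _ _)).trans
    (Cat2Group.s₁_cell (C := S.toCat2Group) _ _ _ _ _ _ _ _ _)

variable (S)

/-- The map `N(∇X)₀ → P`. -/
def mooreToP : moore S.nabla 0 →* S.P where
  toFun x := (mcell x 0 0 0 0).right.right
  map_one' := rfl
  map_mul' _ _ := rfl

theorem mooreToP_injective : Function.Injective S.mooreToP := by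
  refine (injective_iff_map_eq_one _).2 fun x hx => Subtype.ext ?_
  have hx' : (mcell x 0 0 0 0).right.right = 1 := hx
  refine Cat2Group.eq_one_of_cell (C := S.toCat2Group) (n := 0) _ fun i k hik hk => ?_
  obtain rfl : k = 0 := by omega
  obtain rfl : i = 0 := by omega
  refine (s_mcell_0000 x).symm.trans ?_
  ext
  · rfl
  · rfl
  · rfl
  · exact hx'

theorem mooreToP_surjective : Function.Surjective S.mooreToP := by
  intro p
  let F : ℕ → ℕ → S.Big := fun _ _ => ⟨1, ⟨1, p⟩⟩
  let y : codiagSubgroup S.toCat2Group.binerve 0 :=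
    S.toCat2Group.ofGrid F (fun _ _ _ => rfl) (fun _ _ _ => rfl) 0
  refine ⟨⟨y, Subgroup.mem_top _⟩, ?_⟩
  have h : mcell ⟨y, Subgroup.mem_top _⟩ 0 0 0 0 = S.s₁ ⟨1, ⟨1, p⟩⟩ :=
    (Cat2Group.cell_ofGrid S.toCat2Group F (fun _ _ _ => rfl) (fun _ _ _ => rfl)
      ..).trans (Cat2Group.gridSquare_left _ _ _ _ _ rfl)
  exact congrArg (fun z : S.Big => z.right.right) h

end DegreeZero

/-! ### Degree two: the single surviving cell and `L`. -/

section DegreeTwo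

variable (x : moore S.nabla 2)

theorem t₁_mcell_0112 : S.t₁ (mcell x 0 1 1 2) = 1 :=
  (Cat2Group.t₁_cell (C := S.toCat2Group) _ _ _ _ _ _ _ _ _).trans
    (Cat2Group.cell_eq_one_of_mem_moore x.1 x.2 0 (by decide) 1 1 1 2 (by decide) (by decide)
      (by decide) (by decide) (by decide) (by decide) (by decide) (by decide))

theorem t₂_mcell_0112 : S.t₂ (mcell x 0 1 1 2) = 1 := by
  refine (Cat2Group.t₂_cell (C := S.toCat2Group) _ _ _ _ _ _ _ _ _).trans ?_
  -- The target is the cell at `(0, 1, 2, 2)`. It does meet both `0` and `1`, but it is a factor in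
  -- a decomposition of the cell at `(0, 2, 2, 2)`, which avoids `1`, and the other factors avoid
  -- `0`.
  have h := Cat2Group.cell_comp₁ (C := S.toCat2Group) (n := 2) x.1 0 1 2 2 2 (by decide)
    (by decide) (by decide) (by decide) (by decide)
  rw [Cat2Group.cell_eq_one_of_mem_moore x.1 x.2 1 (by decide) 0 2 2 2 _ _ _ _ (by decide)
      (by decide) (by decide) (by decide),
    Cat2Group.cell_eq_one_of_mem_moore x.1 x.2 0 (by decide) 1 2 2 2 _ _ _ _ (by decide)
      (by decide) (by decide) (by decide),
    Cat2Group.cell_eq_one_of_mem_moore x.1 x.2 0 (by decide) 1 1 2 2 _ _ _ _ (by decide)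
      (by decide) (by decide) (by decide), inv_one, one_mul, one_mul] at h
  exact h.symm

/-- The cell at `(0, 0, 0, 2)` avoids the vertex `1` and is trivial; cutting it at `1` in the second
direction expresses the wanted cell through sources of the surviving one. -/
theorem mcell_0001_of_two : mcell x 0 0 0 1 =
    S.s₁ (S.s₂ (mcell x 0 1 1 2)) * (S.s₁ (mcell x 0 1 1 2))⁻¹ := by
  have h := Cat2Group.cell_comp₂ (C := S.toCat2Group) (n := 2) x.1 0 0 0 1 2 (by decide)
    (by decide) (by decide) (by decide) (by decide)
  rw [Cat2Group.cell_eq_one_of_mem_moore x.1 x.2 1 (by decide) 0 0 0 2 _ _ _ _ (by decide)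
      (by decide) (by decide) (by decide)] at h
  have h₁ : S.s₁ (mcell x 0 1 1 2) = mcell x 0 0 1 2 :=
    Cat2Group.s₁_cell (C := S.toCat2Group) _ _ _ _ _ _ _ _ _
  have h₂ : S.s₂ (mcell x 0 1 1 2) = mcell x 0 1 1 1 :=
    Cat2Group.s₂_cell (C := S.toCat2Group) _ _ _ _ _ _ _ _ _
  have h₃ : S.s₁ (mcell x 0 1 1 1) = mcell x 0 0 1 1 :=
    Cat2Group.s₁_cell (C := S.toCat2Group) _ _ _ _ _ _ _ _ _
  rw [h₁, h₂, h₃]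
  have h' : (1 : S.Big) = mcell x 0 0 1 2 * (mcell x 0 0 1 1)⁻¹ * mcell x 0 0 0 1 := h
  rw [← inv_eq_of_mul_eq_one_right h'.symm]
  group

variable (S)

/-- The map `N(∇X)₂ → L`. -/
def mooreToL : moore S.nabla 2 →* S.L where
  toFun x := (mcell x 0 1 1 2).left.left
  map_one' := rfl
  map_mul' x y := left_left_mul_of_t (t₁_mcell_0112 x) (t₂_mcell_0112 y)

theorem mooreToL_injective : Function.Injective S.mooreToL := by
  refine (injective_iff_map_eq_one _).2 fun x hx => Subtype.ext ?_
  have hx' : (mcell x 0 1 1 2).left.left = 1 := hx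
  have hl : (mcell x 0 1 1 2).left = 1 := by
    ext
    · exact hx'
    · rw [left_right_eq_of_t₂ (t₂_mcell_0112 x), hx', map_one, inv_one]
      rfl
  refine Cat2Group.eq_one_of_cell (C := S.toCat2Group) (n := 2) _ fun i k hik hk => ?_
  -- Unless `(i, k) = (0, 1)`, the cell at `(i, k, k, 2)` avoids `0` or `1`.
  by_cases h0 : i = 0
  · by_cases h1 : k = 1
    · subst h0 h1
      refine (SemidirectProduct.ext hl ?_ : mcell x 0 1 1 2 = 1)
      rw [right_eq_of_t₁ (t₁_mcell_0112 x), hl, map_one, inv_one]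
      rfl
    · exact Cat2Group.cell_eq_one_of_mem_moore x.1 x.2 1 (by decide) _ _ _ _ _ _ _ _ (by omega) h1
        h1 (by decide)
  · exact Cat2Group.cell_eq_one_of_mem_moore x.1 x.2 0 (by decide) _ _ _ _ _ _ _ _ h0 (by omega)
      (by omega) (by decide)

theorem mooreToL_surjective : Function.Surjective S.mooreToL := by
  intro l
  -- All targets are trivial, so any single nontrivial entry is allowed; it is placed at the entry
  -- that becomes the cell at `(0, 1, 1, 2)`.
  let F : ℕ → ℕ → S.Big := fun i k => if i = 0 ∧ k = 1 then S.bigL l else 1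
  have hF (i k : ℕ) (h : ¬ (i = 0 ∧ k = 1)) : F i k = 1 := if_neg h
  have h₁ (i k : ℕ) : S.t₁ (F i k) = 1 := by
    by_cases h : i = 0 ∧ k = 1
    · simp only [F, if_pos h, S.t₁_bigL]
    · rw [hF i k h, map_one]
  have h₂ (i k : ℕ) : S.t₂ (F i k) = 1 := by
    by_cases h : i = 0 ∧ k = 1
    · simp only [F, if_pos h, S.t₂_bigL]
    · rw [hF i k h, map_one]
  have h₁' (i i' k : ℕ) := (h₁ i k).trans (h₁ i' k).symm
  have h₂' (i k k' : ℕ) := (h₂ i k).trans (h₂ i k').symm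
  let y : codiagSubgroup S.toCat2Group.binerve 2 := S.toCat2Group.ofGrid F h₁' h₂' 2
  have hsq (i k : ℕ) : S.toCat2Group.gridSquare F i k k 2 = F i k :=
    Cat2Group.gridSquare_corner _ _ _ _ _ _ (hF k k (by omega)) (hF k 2 (by omega)) (hF i 2 (by omega))
  have hy : y ∈ moore S.nabla 2 := by
    refine Cat2Group.mem_moore_of_cell _ fun q i k hq hik hk hi hk' => ?_
    exact (Cat2Group.cell_ofGrid S.toCat2Group F h₁' h₂' ..).trans ((hsq i k).trans (hF i k (by omega)))
  refine ⟨⟨y, hy⟩, ?_⟩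
  have h : mcell ⟨y, hy⟩ 0 1 1 2 = S.bigL l := (Cat2Group.cell_ofGrid S.toCat2Group F h₁' h₂' ..).trans (hsq 0 1)
  exact congrArg (fun z : S.Big => z.left.left) h

end DegreeTwo

/-! ### Comparison of the differentials. -/

section Comparison

theorem mcell_mooreD {n : ℕ} (x : moore S.nabla (n + 1)) (i j k l : ℕ) (hij : i ≤ j)
    (hjk : j ≤ k) (hkl : k ≤ l) (hl : l ≤ n) :
    mcell (mooreD S.nabla n x) i j k l hij hjk hkl hl = mcell x i j k l hij hjk hkl (by omega) :=
  Cat2Group.cell_face_last _ _ _ _ _ _ _ _ _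

variable (S)

theorem mooreToP_mooreD (x : moore S.nabla 1) :
    S.mooreToP (mooreD S.nabla 0 x) = S.mapD₁ (S.mooreToMN x) := by
  have h : mcell x 0 0 0 0 = S.s₂ (mcell x 0 0 0 1) :=
    (Cat2Group.s₂_cell (C := S.toCat2Group) _ _ _ _ _ _ _ _ _).symm
  change (mcell (mooreD S.nabla 0 x) 0 0 0 0).right.right = _
  rw [mcell_mooreD, h, mcell_0001]
  rfl

theorem mooreToMN_mooreD (x : moore S.nabla 2) :
    S.mooreToMN (mooreD S.nabla 1 x) = S.mapD₂ (S.mooreToL x) := by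
  have h : mcell x 0 1 1 1 = S.s₂ (mcell x 0 1 1 2) :=
    (Cat2Group.s₂_cell (C := S.toCat2Group) _ _ _ _ _ _ _ _ _).symm
  change toMN _ = _
  rw [toMN, mcell_mooreD, mcell_mooreD, h, mcell_0001_of_two]
  ext
  · change _ = (S.lam (mcell x 0 1 1 2).left.left)⁻¹
    rw [← right_left_of_t (t₁_mcell_0112 x) (t₂_mcell_0112 x)]
    simp [s₁, s₂]
  · change _ = S.lam' (mcell x 0 1 1 2).left.left
    rw [← inv_inv (S.lam' _), ← left_right_eq_of_t₂ (t₂_mcell_0112 x)]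
    rfl

/-- The components of the isomorphism from the Moore complex of `∇X` to the mapping complex. -/
noncomputable def mooreEquiv : (n : ℕ) → moore S.nabla n ≃* S.mapX n
  | 0 => MulEquiv.ofBijective S.mooreToP ⟨S.mooreToP_injective, S.mooreToP_surjective⟩
  | 1 => MulEquiv.ofBijective S.mooreToMN ⟨S.mooreToMN_injective, S.mooreToMN_surjective⟩
  | 2 => MulEquiv.ofBijective S.mooreToL ⟨S.mooreToL_injective, S.mooreToL_surjective⟩
  | n + 3 => MulEquiv.ofBijective (1 : moore S.nabla (n + 3) →* PUnit)
      ⟨fun x y _ => Subtype.ext ((Cat2Group.eq_one_of_mem_moore x.1 x.2).trans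
        (Cat2Group.eq_one_of_mem_moore y.1 y.2).symm), fun _ => ⟨1, rfl⟩⟩

/-- The Moore complex of `∇X` is isomorphic to the mapping complex. -/
noncomputable def mooreComplexIso : (mooreComplex S.nabla).Iso S.mappingComplex where
  equiv := S.mooreEquiv
  comm
    | 0, x => S.mooreToP_mooreD x
    | 1, x => S.mooreToMN_mooreD x
    | 2, x => by
      have hx : x = 1 := Subtype.ext (Cat2Group.eq_one_of_mem_moore x.1 x.2)
      rw [hx]
      exact (congrArg (S.mooreEquiv 2) (map_one (mooreD S.nabla 2))).trans
        (map_one (S.mooreEquiv 2))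
    | _ + 3, _ => rfl

end Comparison

end CrossedSquare

end CrossedSquares

namespace CrossedSquares

/-! ### Homology -/

/-- The isomorphism theorem in the form used for every homology comparison: a surjection under which
one normal subgroup is the full preimage of the other. -/
theorem nonempty_quotient_mulEquiv {A B : Type*} [Group A] [Group B] (N : Subgroup A) [N.Normal]
    (M : Subgroup B) [M.Normal] (φ : A →* B) (hφ : ∀ a, a ∈ N ↔ φ a ∈ M)
    (hs : Function.Surjective φ) : Nonempty (A ⧸ N ≃* B ⧸ M) := by
  refine ⟨MulEquiv.ofBijective (QuotientGroup.map N M φ fun a ha => (hφ a).1 ha) ⟨?_, ?_⟩⟩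
  · refine (injective_iff_map_eq_one _).2 fun x hx => ?_
    obtain ⟨a, rfl⟩ := QuotientGroup.mk_surjective x
    exact (QuotientGroup.eq_one_iff a).2 ((hφ a).2 ((QuotientGroup.eq_one_iff (φ a)).1 hx))
  · intro y
    obtain ⟨b, rfl⟩ := QuotientGroup.mk_surjective y
    obtain ⟨a, rfl⟩ := hs b
    exact ⟨a, rfl⟩

/-- Isomorphic complexes have isomorphic homology. -/
theorem NormalComplex.Iso.nonempty_homology_mulEquiv {C D : NormalComplex.{u}} (e : C.Iso D)
    (n : ℕ) : Nonempty (C.homology n ≃* D.homology n) := by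
  have hc : ∀ x, x ∈ C.cycles n ↔ e.equiv n x ∈ D.cycles n := by
    cases n with
    | zero => exact fun x => ⟨fun _ => Subgroup.mem_top _, fun _ => Subgroup.mem_top _⟩
    | succ n =>
      intro x
      change C.d n x = 1 ↔ D.d n (e.equiv (n + 1) x) = 1
      rw [← e.comm, map_eq_one_iff _ (e.equiv n).injective]
  refine nonempty_quotient_mulEquiv _ _
    (((e.equiv n).toMonoidHom.comp (C.cycles n).subtype).codRestrict (D.cycles n)
      fun x => (hc x).1 x.2) (fun a => ?_) ?_
  · rw [Subgroup.mem_subgroupOf, Subgroup.mem_subgroupOf]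
    constructor
    · rintro ⟨y, hy⟩
      exact ⟨e.equiv (n + 1) y, (e.comm n y).symm.trans (congrArg (e.equiv n) hy)⟩
    · rintro ⟨y, hy⟩
      refine ⟨(e.equiv (n + 1)).symm y, (e.equiv n).injective ?_⟩
      rw [e.comm, MulEquiv.apply_symm_apply]
      exact hy
  · intro y
    exact ⟨⟨(e.equiv n).symm y, (hc _).2 (by rw [MulEquiv.apply_symm_apply]; exact y.2)⟩,
      Subtype.ext ((e.equiv n).apply_symm_apply y)⟩

/-! ### Homology of the mapping complex of `𝔐(G, 2)`. -/

section SquareOf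

variable (G : SimplicialGroup.{u})

theorem mem_moore_one (x : level G 1) : x ∈ moore G 1 ↔ face G 0 0 x = 1 := by
  rw [mem_moore_succ, Fin.forall_fin_one]
  rfl

/-- The face `d₁ : G₁ → G₀` is split by `s₀`, and the preimage of `d₁(Ker d₀)` under it is `Ker d₀ ·
Ker d₁`. -/
theorem nonempty_homology_zero :
    Nonempty ((squareOf G).mappingComplex.homology 0 ≃* homotopyGroup G 0) := by
  refine nonempty_quotient_mulEquiv _ _
    ((((face G 0 1).codRestrict (moore G 0) fun _ => Subgroup.mem_top _).comp
      ((squareOf G).mappingComplex.cycles 0).subtype).codRestrict ((mooreComplex G).cycles 0)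
      fun _ => Subgroup.mem_top _) ?_ ?_
  · rintro ⟨p, hp⟩
    change level G 1 at p
    rw [Subgroup.mem_subgroupOf, Subgroup.mem_subgroupOf]
    constructor
    · rintro ⟨⟨m, n⟩, h⟩
      have h' : m.1 * n.1 = p := h
      refine ⟨⟨m.1, (mem_moore_one G _).2 m.2⟩, Subtype.ext ?_⟩
      change face G 0 1 m.1 = face G 0 1 p
      rw [← h', map_mul, n.2, mul_one]
    · rintro ⟨z, h⟩
      have h' : face G 0 1 z.1 = face G 0 1 p := congrArg Subtype.val h
      -- If `d₁ z = d₁ p` with `z ∈ Ker d₀`, then `p = z (z⁻¹ p)` and `z⁻¹ p ∈ Ker d₁`.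
      refine ⟨⟨⟨z.1, (mem_moore_one G _).1 z.2⟩, ⟨z.1⁻¹ * p, ?_⟩⟩, mul_inv_cancel_left z.1 p⟩
      rw [MonoidHom.mem_ker, map_mul, map_inv, h', inv_mul_cancel]
  · rintro ⟨⟨y, hy⟩, hy'⟩
    exact ⟨⟨degen G 0 0 y, Subgroup.mem_top _⟩,
      Subtype.ext (Subtype.ext (face_degen_succ G 0 0 y))⟩

/-- A cycle `(m, n)` has `m n = 1` in `G₁`, so it is determined by `n`, which lies in `Ker d₀` as
the inverse of `m`. Projection to `n` carries `∂₂ l` to `λ'(l)`, that is, to `d₂` of a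
representative of `l`. -/
theorem nonempty_homology_one :
    Nonempty ((squareOf G).mappingComplex.homology 1 ≃* homotopyGroup G 1) := by
  have hker : ∀ x : (squareOf G).mappingComplex.cycles 1,
      (show (squareOf G).MN from x.1).left.1 * (show (squareOf G).MN from x.1).right.1 = 1 :=
    fun x => x.2
  have hm : ∀ x : (squareOf G).mappingComplex.cycles 1,
      (show (squareOf G).MN from x.1).right.1 ∈ moore G 1 := fun x => by
    have h := congrArg (face G 0 0) (hker x)
    rw [map_mul, map_one, (show (squareOf G).MN from x.1).left.2, one_mul] at h
    exact (mem_moore_one G _).2 h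
  let φ : (squareOf G).mappingComplex.cycles 1 →* moore G 1 :=
    ((face G 0 1).ker.subtype.comp ((SemidirectProduct.rightHom (φ :=
      (squareOf G).actM.comp (squareOf G).nu)).comp
        ((squareOf G).mappingComplex.cycles 1).subtype)).codRestrict (moore G 1) hm
  refine nonempty_quotient_mulEquiv _ _ (φ.codRestrict ((mooreComplex G).cycles 1)
    fun x => Subtype.ext (show (squareOf G).MN from x.1).right.2) ?_ ?_
  · intro x
    rw [Subgroup.mem_subgroupOf, Subgroup.mem_subgroupOf]
    constructor
    · rintro ⟨l, h⟩
      obtain ⟨l, rfl⟩ := QuotientGroup.mk_surjective (s := (mooreD G 2).range) l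
      exact ⟨l, Subtype.ext (congrArg (fun y : (squareOf G).MN => y.right.1) h)⟩
    · rintro ⟨z, h⟩
      have h' : face G 1 2 z.1 = (show (squareOf G).MN from x.1).right.1 := congrArg Subtype.val h
      refine ⟨(QuotientGroup.mk z : topQuot G), ?_⟩
      refine SemidirectProduct.ext (Subtype.ext ?_) (Subtype.ext h')
      change (face G 1 2 z.1)⁻¹ = (show (squareOf G).MN from x.1).left.1
      rw [h']
      exact inv_eq_of_mul_eq_one_left (hker x)
  · rintro ⟨⟨y, hy⟩, hy'⟩
    have h₁ : face G 0 1 y = 1 := congrArg Subtype.val hy'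
    refine ⟨⟨(⟨⟨y⁻¹, ?_⟩, ⟨y, h₁⟩⟩ : (squareOf G).MN), inv_mul_cancel y⟩, rfl⟩
    rw [MonoidHom.mem_ker, map_inv, (mem_moore_one G y).1 hy, inv_one]

/-- The mapping complex is trivial in degree three because `∂₃ NG₃` has already been divided out of
`L`. The comparison is the quotient map restricted to cycles; it runs from the Moore complex of `G`
to the mapping complex, hence the final symmetry. -/
theorem nonempty_homology_two :
    Nonempty ((squareOf G).mappingComplex.homology 2 ≃* homotopyGroup G 2) := by
  have hc : ∀ z : (mooreComplex G).cycles 2,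
      (QuotientGroup.mk z.1 : topQuot G) ∈ (squareOf G).mappingComplex.cycles 2 := fun z => by
    have h : face G 1 2 z.1.1 = 1 := congrArg Subtype.val z.2
    exact SemidirectProduct.ext (inv_eq_one.2 (Subtype.ext h)) (Subtype.ext h)
  refine Nonempty.map MulEquiv.symm (nonempty_quotient_mulEquiv
    (((mooreComplex G).d 2).range.subgroupOf ((mooreComplex G).cycles 2))
    (((squareOf G).mappingComplex.d 2).range.subgroupOf ((squareOf G).mappingComplex.cycles 2))
    (((QuotientGroup.mk' (mooreD G 2).range).comp ((mooreComplex G).cycles 2).subtype).codRestrict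
      ((squareOf G).mappingComplex.cycles 2) hc) (fun z => ?_) ?_)
  · rw [Subgroup.mem_subgroupOf, Subgroup.mem_subgroupOf]
    constructor
    · intro h
      exact ⟨1, ((QuotientGroup.eq_one_iff (N := (mooreD G 2).range) z.1).2 h).symm⟩
    · rintro ⟨w, h⟩
      exact (QuotientGroup.eq_one_iff (N := (mooreD G 2).range) z.1).1 h.symm
  · rintro ⟨l, hl⟩
    obtain ⟨z, rfl⟩ := QuotientGroup.mk_surjective (s := (mooreD G 2).range) l
    have h : (squareOf G).mapD₂ (QuotientGroup.mk z : topQuot G) = 1 := hl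
    exact ⟨⟨z, Subtype.ext (congrArg (fun y : (squareOf G).MN => y.right.1) h)⟩, rfl⟩

end SquareOf

end CrossedSquares

/-- For a simplicial group `G`, let `X` be the bisimplicial nerve of the crossed square `𝔐(G, 2)`.
The Moore complex of the codiagonal `∇X` is isomorphic to the complex
`NG₂ / ∂₃ NG₃ → Ker d₀ ⋊ Ker d₁ → G₁` (trivial in degrees `≥ 3`), and the homology of this
complex, i.e. the homotopy of `∇X`, in degrees `0`, `1`, `2` is isomorphic to the homotopy groups
`π₀(G)`, `π₁(G)`, `π₂(G)`. -/
theorem mainTheorem6 (G : CrossedSquares.SimplicialGroup.{u}) :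
    Nonempty (CrossedSquares.NormalComplex.Iso
      (CrossedSquares.mooreComplex
        (CrossedSquares.codiagonal (CrossedSquares.squareOf G).binerve))
      (CrossedSquares.squareOf G).mappingComplex) ∧
    ∀ n : ℕ, n ≤ 2 →
      Nonempty ((CrossedSquares.squareOf G).mappingComplex.homology n ≃*
        CrossedSquares.homotopyGroup G n) ∧
      Nonempty (CrossedSquares.homotopyGroup
          (CrossedSquares.codiagonal (CrossedSquares.squareOf G).binerve) n ≃*
        CrossedSquares.homotopyGroup G n) := by
  refine ⟨⟨(CrossedSquares.squareOf G).mooreComplexIso⟩, fun n hn => ?_⟩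
  have h : Nonempty ((CrossedSquares.squareOf G).mappingComplex.homology n ≃*
      CrossedSquares.homotopyGroup G n) := by
    interval_cases n
    · exact CrossedSquares.nonempty_homology_zero G
    · exact CrossedSquares.nonempty_homology_one G
    · exact CrossedSquares.nonempty_homology_two G
  obtain ⟨e⟩ := h
  obtain ⟨f⟩ := (CrossedSquares.squareOf G).mooreComplexIso.nonempty_homology_mulEquiv n
  exact ⟨⟨e⟩, ⟨f.trans e⟩⟩
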